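/- Let $B=(B_m,g_B)$ and $F=(F_k,g_F)$ be (smooth, boundaryless) pseudo-Riemannian manifolds of dimensions $m\ge 2$ and $k\ge 0$, with scalar curvatures $S_B$ and $S_F$. Let $\mu\in\mathbb{R}$, let $\psi\in C^\infty(B)$ with $\psi>0$, and let $S$ be the scalar curvature of the $(\psi,\mu)$-base conformal warped product, i.e. of the product manifold $B\times F$ with the metric $g=\psi^{2\mu}g_B+\psi^2 g_F$. Write $\Delta_B=\nabla^i\nabla_i$ for the Laplace–Beltrami operator of $(B,g_B)$ and $|\nabla^B\psi|_B^2=g_B(\nabla^B\psi,\nabla^B\psi)$. (i) Suppose $\mu\neq-\frac{k}{m-1}$ and $(m,k)\neq(2,0)$. Put $$\alpha=\frac{2[k+(m-1)\mu]}{\{[k+(m-1)\mu]+(1-\mu)\}k+(m-2)\mu[k+(m-1)\mu]},\qquad \beta=\alpha\,2[k+(m-1)\mu].$$ Then $\beta>0$, there is a positive $u\in C^\infty(B)$ with $\psi=u^\alpha$, and every positive function $u$ on $B$ with $\psi=u^\alpha$ is smooth and satisfies $$-\beta\Delta_B u+S_B u=S\,u^{2\mu\alpha+1}-S_F\,u^{2(\mu-1)\alpha+1}\quad\text{on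 } B\times F.$$ (ii) If $\mu=-\frac{k}{m-1}$, then on $B\times F$ $$-k\left[1+\frac{k}{m-1}\right]\frac{|\nabla^B\psi|_B^2}{\psi^2}=\psi^{-2\frac{k}{m-1}}\left[S-S_F\psi^{-2}\right]-S_B.$$ -/

import Mathlib

open Bundle Manifold
open scoped ContDiff Topology

noncomputable section

/-! ### Calculus of a metric on (an open subset of) a finite-dimensional vector space

Here `G : E → E →L[ℝ] E →L[ℝ] ℝ` is the coordinate expression of a metric tensor: `G y v w` is the
scalar product of `v` and `w` at the point `y`.  As `G y` is the map `v ↦ G y v ·` from `E` to its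
dual, `(G y).inverse` raises an index. -/

namespace MetricCalculus

variable {E : Type*} [NormedAddCommGroup E] [NormedSpace ℝ E]

/-- The Christoffel symbol `Γ(u, v) = ∇_u v - D_u v` of the Levi-Civita connection of `G`:
`G(Γ(u, v), w) = 1/2 (D_u G(v, w) + D_v G(u, w) - D_w G(u, v))` for all `w`. -/
def christoffel (G : E → E →L[ℝ] E →L[ℝ] ℝ) (y u v : E) : E :=
  (G y).inverse ((1 / 2 : ℝ) • (fderiv ℝ (fun z => G z v) y u + fderiv ℝ (fun z => G z u) y v
    - fderiv ℝ (fun z => G z u v) y))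

/-- The Riemann curvature `R(u, v) w = ∇_u ∇_v w - ∇_v ∇_u w`, for constant vector fields
`u`, `v`, `w` (whose brackets vanish). -/
def riemann (G : E → E →L[ℝ] E →L[ℝ] ℝ) (y u v w : E) : E :=
  fderiv ℝ (fun z => christoffel G z v w) y u - fderiv ℝ (fun z => christoffel G z u w) y v
    + christoffel G y u (christoffel G y v w) - christoffel G y v (christoffel G y u w)

/-- The Hessian `H^f(u, v) = D_u D_v f - Df(Γ(u, v))`. -/
def hessian (G : E → E →L[ℝ] E →L[ℝ] ℝ) (f : E → ℝ) (y u v : E) : ℝ :=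
  fderiv ℝ (fun z => fderiv ℝ f z v) y u - fderiv ℝ f y (christoffel G y u v)

variable [FiniteDimensional ℝ E]

/-- The Ricci tensor `Ric(v, w) = tr (u ↦ R(u, v) w)`, the trace being computed in a basis. -/
def ricci (G : E → E →L[ℝ] E →L[ℝ] ℝ) (y v w : E) : ℝ :=
  ∑ i, (Module.finBasis ℝ E).coord i (riemann G y (Module.finBasis ℝ E i) v w)

/-- The trace `∑ᵢⱼ G^{ij} T(eᵢ, eⱼ)` of a bilinear form `T` with respect to the metric at `y`,
where `∑ⱼ G^{ij} eⱼ` is the vector obtained by raising the index of the dual basis covector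
`e^i`. -/
def metricTrace (G : E → E →L[ℝ] E →L[ℝ] ℝ) (y : E) (T : E → E → ℝ) : ℝ :=
  ∑ i, T (Module.finBasis ℝ E i)
    ((G y).inverse (LinearMap.toContinuousLinearMap ((Module.finBasis ℝ E).coord i)))

/-- The scalar curvature, i.e. the metric trace of the Ricci tensor. -/
def scalarCurvature (G : E → E →L[ℝ] E →L[ℝ] ℝ) (y : E) : ℝ :=
  metricTrace G y (ricci G y)

/-- The Laplace-Beltrami operator, i.e. the metric trace of the Hessian. -/
def laplacian (G : E → E →L[ℝ] E →L[ℝ] ℝ) (f : E → ℝ) (y : E) : ℝ :=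
  metricTrace G y (hessian G f y)

end MetricCalculus

/-! ### Pseudo-Riemannian metrics on manifolds -/

/-- A smooth pseudo-Riemannian metric on a manifold `M`: a smooth symmetric nondegenerate
`(0, 2)`-tensor field. -/
structure PseudoRiemannianMetric {E : Type*} [NormedAddCommGroup E] [NormedSpace ℝ E]
    {H : Type*} [TopologicalSpace H] (I : ModelWithCorners ℝ E H)
    (M : Type*) [TopologicalSpace M] [ChartedSpace H M] [IsManifold I ∞ M] where
  /-- The scalar product on each tangent space. -/
  inner (x : M) : TangentSpace I x →L[ℝ] TangentSpace I x →L[ℝ] ℝ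
  symm (x : M) (v w : TangentSpace I x) : inner x v w = inner x w v
  nondegenerate (x : M) (v : TangentSpace I x) (hv : ∀ w, inner x v w = 0) : v = 0
  contMDiff : ContMDiff I (I.prod 𝓘(ℝ, E →L[ℝ] E →L[ℝ] ℝ)) ∞
    (fun x ↦ TotalSpace.mk' (E →L[ℝ] E →L[ℝ] ℝ)
      (E := fun x ↦ TangentSpace I x →L[ℝ] TangentSpace I x →L[ℝ] ℝ) x (inner x))

namespace PseudoRiemannianMetric

section Operators

variable {E : Type*} [NormedAddCommGroup E] [NormedSpace ℝ E]
  {H : Type*} [TopologicalSpace H] {I : ModelWithCorners ℝ E H}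
  {M : Type*} [TopologicalSpace M] [ChartedSpace H M] [IsManifold I ∞ M]
  {E' : Type*} [NormedAddCommGroup E'] [NormedSpace ℝ E']
  {H' : Type*} [TopologicalSpace H'] {I' : ModelWithCorners ℝ E' H'}
  {N : Type*} [TopologicalSpace N] [ChartedSpace H' N]

/-- The pullback `f^* g` of a metric under a map, as a (possibly degenerate) tensor field. -/
def pullback (g : PseudoRiemannianMetric I M) (f : N → M) (x : N) :
    TangentSpace I' x →L[ℝ] TangentSpace I' x →L[ℝ] ℝ :=
  let D : E' →L[ℝ] E := mfderiv I' I f x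
  let G : E →L[ℝ] E →L[ℝ] ℝ := g.inner (f x)
  (G.bilinearComp D D : E' →L[ℝ] E' →L[ℝ] ℝ)

theorem pullback_apply (g : PseudoRiemannianMetric I M) (f : N → M) (x : N)
    (v w : TangentSpace I' x) :
    g.pullback f x v w = g.inner (f x) (mfderiv I' I f x v) (mfderiv I' I f x w) := rfl

set_option synthInstance.maxHeartbeats 200000 in
theorem contMDiff_pullback [IsManifold I' ∞ N] (g : PseudoRiemannianMetric I M) {f : N → M}
    (hf : ContMDiff I' I ∞ f) :
    ContMDiff I' (I'.prod 𝓘(ℝ, E' →L[ℝ] E' →L[ℝ] ℝ)) ∞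
      (fun x ↦ TotalSpace.mk' (E' →L[ℝ] E' →L[ℝ] ℝ)
        (E := fun x ↦ TangentSpace I' x →L[ℝ] TangentSpace I' x →L[ℝ] ℝ) x
        (g.pullback (I' := I') f x)) := by
  intro x₀
  rw [contMDiffAt_hom_bundle]
  refine ⟨contMDiffAt_id, ?_⟩
  have hg := ((contMDiffAt_hom_bundle _).1 ((g.contMDiff (f x₀)).comp x₀ (hf x₀))).2
  have hD := ContMDiffAt.mfderiv_const (m := ∞) (hf x₀) (by simp)
  have key : ContMDiffAt I' 𝓘(ℝ, E' →L[ℝ] E' →L[ℝ] ℝ) ∞ (fun x ↦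
      ((ContinuousLinearMap.compL ℝ E' E ℝ).flip
        (inTangentCoordinates I' I id f (mfderiv I' I f) x₀ x)) ∘L
      ((ContinuousLinearMap.inCoordinates E (TangentSpace I) (E →L[ℝ] ℝ)
        (fun x ↦ TangentSpace I x →L[ℝ] ℝ) (f x₀) (f x) (f x₀) (f x) (g.inner (f x))) ∘L
        (inTangentCoordinates I' I id f (mfderiv I' I f) x₀ x))) x₀ :=
    ContMDiffAt.clm_comp (ContMDiffAt.clm_apply contMDiffAt_const hD)
      (ContMDiffAt.clm_comp hg hD)
  refine key.congr_of_eventuallyEq ?_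
  have h1 : ∀ᶠ x in 𝓝 x₀, x ∈ (trivializationAt E' (TangentSpace I' (M := N)) x₀).baseSet :=
    (trivializationAt E' (TangentSpace I' (M := N)) x₀).open_baseSet.mem_nhds
      (FiberBundle.mem_baseSet_trivializationAt' x₀)
  have h2 : ∀ᶠ x in 𝓝 x₀,
      f x ∈ (trivializationAt E (TangentSpace I (M := M)) (f x₀)).baseSet :=
    hf.continuous.continuousAt
      ((trivializationAt E (TangentSpace I (M := M)) (f x₀)).open_baseSet.mem_nhds
        (FiberBundle.mem_baseSet_trivializationAt' (f x₀)))
  filter_upwards [h1, h2] with x hx1 hx2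
  ext v w
  rw [inCoordinates_apply_eq₂ hx1 hx1 (by simp)]
  simp only [ContinuousLinearMap.comp_apply, ContinuousLinearMap.flip_apply,
    ContinuousLinearMap.compL_apply]
  rw [inCoordinates_apply_eq₂ hx2 hx2 (by simp)]
  have hD' : ∀ v : E', (trivializationAt E (TangentSpace I (M := M)) (f x₀)).symm (f x)
      (inTangentCoordinates I' I id f (mfderiv I' I f) x₀ x v) =
      mfderiv I' I f x ((trivializationAt E' (TangentSpace I' (M := N)) x₀).symm x v) := by
    intro v
    change (trivializationAt E (TangentSpace I (M := M)) (f x₀)).symm (f x)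
      (ContinuousLinearMap.inCoordinates E' (TangentSpace I') E (TangentSpace I)
        x₀ x (f x₀) (f x) (mfderiv I' I f x) v) = _
    rw [ContinuousLinearMap.inCoordinates_eq hx1 hx2]
    simp only [ContinuousLinearMap.comp_apply, ContinuousLinearEquiv.coe_coe,
      Trivialization.continuousLinearEquivAt_apply, Trivialization.symm_continuousLinearEquivAt_eq]
    rw [Trivialization.symmL_apply _ hx1]
    exact (trivializationAt E (TangentSpace I (M := M)) (f x₀)).symm_proj_apply ⟨f x, _⟩ hx2
  rw [hD', hD']
  rfl

/-- The gradient of a function, `g(grad f, v) = df(v)`. -/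
def grad (g : PseudoRiemannianMetric I M) (f : M → ℝ) (x : M) : TangentSpace I x :=
  (g.inner x).inverse (mvfderiv I f x)

/-- `|∇f|² = g(grad f, grad f)`; for an indefinite metric this may be negative. -/
def normSqGrad (g : PseudoRiemannianMetric I M) (f : M → ℝ) (x : M) : ℝ :=
  g.inner x (g.grad f x) (g.grad f x)

/-- The coordinate expression of the metric in the chart around `x₀`, i.e. the pullback of the
metric under the inverse of the chart. -/
def inChart (g : PseudoRiemannianMetric I M) (x₀ : M) (y : E) : E →L[ℝ] E →L[ℝ] ℝ :=
  g.pullback (I' := 𝓘(ℝ, E)) (extChartAt I x₀).symm y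

variable [FiniteDimensional ℝ E]

/-- The scalar curvature at `x`, computed in the chart around `x`. -/
def scalarCurvature (g : PseudoRiemannianMetric I M) (x : M) : ℝ :=
  MetricCalculus.scalarCurvature (g.inChart x) (extChartAt I x x)

/-- The Laplace-Beltrami operator `Δ f = ∇ⁱ∇ᵢ f` at `x`, computed in the chart around `x`. -/
def laplacian (g : PseudoRiemannianMetric I M) (f : M → ℝ) (x : M) : ℝ :=
  MetricCalculus.laplacian (g.inChart x) (f ∘ (extChartAt I x).symm) (extChartAt I x x)

end Operators

section BaseConformalWarpedProduct

variable {EB : Type*} [NormedAddCommGroup EB] [NormedSpace ℝ EB]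
  {HB : Type*} [TopologicalSpace HB] {IB : ModelWithCorners ℝ EB HB}
  {B : Type*} [TopologicalSpace B] [ChartedSpace HB B] [IsManifold IB ∞ B]
  {EF : Type*} [NormedAddCommGroup EF] [NormedSpace ℝ EF]
  {HF : Type*} [TopologicalSpace HF] {IF : ModelWithCorners ℝ EF HF}
  {F : Type*} [TopologicalSpace F] [ChartedSpace HF F] [IsManifold IF ∞ F]

set_option synthInstance.maxHeartbeats 400000 in
/-- The `[c, w]`-base conformal warped product: the metric `c² g_B + w² g_F` on `B × F`, where
`g_B` and `g_F` are pulled back under the projections. -/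
def bcwp (gB : PseudoRiemannianMetric IB B) (gF : PseudoRiemannianMetric IF F)
    (c w : B → ℝ) (hc : ContMDiff IB 𝓘(ℝ) ∞ c) (hc0 : ∀ x, 0 < c x)
    (hw : ContMDiff IB 𝓘(ℝ) ∞ w) (hw0 : ∀ x, 0 < w x) :
    PseudoRiemannianMetric (IB.prod IF) (B × F) where
  inner p := c p.1 ^ 2 • gB.pullback (I' := IB.prod IF) Prod.fst p
    + w p.1 ^ 2 • gF.pullback (I' := IB.prod IF) Prod.snd p
  symm p v w := by
    simp only [add_apply, smul_apply, pullback_apply]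
    rw [gB.symm, gF.symm]
  nondegenerate p v hv := by
    have hfst : ∀ u : TangentSpace (IB.prod IF) p,
        mfderiv (IB.prod IF) IB Prod.fst p u = u.1 := fun u => by rw [mfderiv_fst]; rfl
    have hsnd : ∀ u : TangentSpace (IB.prod IF) p,
        mfderiv (IB.prod IF) IF Prod.snd p u = u.2 := fun u => by rw [mfderiv_snd]; rfl
    have key : ∀ u : TangentSpace (IB.prod IF) p,
        c p.1 ^ 2 * gB.inner p.1 v.1 u.1 + w p.1 ^ 2 * gF.inner p.2 v.2 u.2 = 0 := by
      intro u
      rw [← hfst, ← hfst, ← hsnd, ← hsnd]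
      exact hv u
    refine Prod.ext (gB.nondegenerate p.1 v.1 fun a => ?_) (gF.nondegenerate p.2 v.2 fun a => ?_)
    · have h := key (a, 0)
      rw [show gF.inner p.2 v.2 ((a, 0) : EB × EF).2 = 0 from map_zero _, mul_zero,
        add_zero] at h
      exact (mul_eq_zero.1 h).resolve_left (pow_ne_zero 2 (hc0 p.1).ne')
    · have h := key (0, a)
      rw [show gB.inner p.1 v.1 ((0, a) : EB × EF).1 = 0 from map_zero _, mul_zero,
        zero_add] at h
      exact (mul_eq_zero.1 h).resolve_left (pow_ne_zero 2 (hw0 p.1).ne')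
  contMDiff := by
    have h := ContMDiff.add_section
      (ContMDiff.smul_section (f := fun p : B × F => c p.1 ^ 2) ((hc.comp contMDiff_fst).pow 2)
        (gB.contMDiff_pullback (contMDiff_fst (I := IB) (J := IF) (M := B) (N := F))))
      (ContMDiff.smul_section (f := fun p : B × F => w p.1 ^ 2) ((hw.comp contMDiff_fst).pow 2)
        (gF.contMDiff_pullback (contMDiff_snd (I := IB) (J := IF) (M := B) (N := F))))
    exact h

/-- The `(ψ, μ)`-base conformal warped product, i.e. the `[ψ^μ, ψ]`-base conformal warped
product, with metric `ψ^(2μ) g_B + ψ² g_F`. -/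
def psiMuBcwp (gB : PseudoRiemannianMetric IB B) (gF : PseudoRiemannianMetric IF F)
    (ψ : B → ℝ) (μ : ℝ) (hψ : ContMDiff IB 𝓘(ℝ) ∞ ψ) (hψ0 : ∀ x, 0 < ψ x) :
    PseudoRiemannianMetric (IB.prod IF) (B × F) :=
  gB.bcwp gF (fun x => ψ x ^ μ) ψ
    (fun x => (Real.contDiffAt_rpow_const_of_ne (hψ0 x).ne').contMDiffAt.comp x (hψ x))
    (fun x => Real.rpow_pos_of_pos (hψ0 x) μ) hψ hψ0

end BaseConformalWarpedProduct

end PseudoRiemannianMetric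

end

/-!
The metric `ψ^(2μ) g_B + ψ² g_F` equals `ψ² (ψ^(2(μ-1)) g_B ⊕ g_F)`: it is a conformal change of the
direct product of a conformal change of `g_B` with `g_F`. So its scalar curvature follows from two
classical facts.

* For a conformal metric `e^(2φ) G` in dimension `n`, the scalar curvature is
  `e^(-2φ) (S - 2 (n - 1) Δφ - (n - 2) (n - 1) |∇φ|²)` and the Laplacian of `f` is
  `e^(-2φ) (Δf + (n - 2) ⟨∇f, ∇φ⟩)` (`scalarCurvature_conformal`, `laplacian_conformal`). This comes
  from the formula for the difference of the two Levi-Civita connections, which gives the Riemann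
  tensor, and by taking traces the Ricci tensor and the scalar curvature.
* For a direct product, the scalar curvature is the sum of those of the factors, and Laplacians and
  gradients of functions on the first factor are computed there (`scalarCurvature_prod`,
  `laplacian_prod`, `gradInner_prod`).

With `θ = log ψ`, `κ = k + (m - 1) μ` and
`D = (m - 1) (m - 2) μ² + 2 (m - 2) k μ + k² + k` they give
`ψ^(2μ) S = S_B - 2 κ Δθ - D |∇θ|² + ψ^(2(μ-1)) S_F` (`scalarCurvature_warped` in a vector space,
`scalarCurvature_psiMuBcwp` on manifolds, by computing in a product chart). If `κ = 0` this is the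
second claim. Otherwise `D > 0`, `α = 2κ / D` and `β = 4κ² / D`, and for `u = ψ^(1/α)` the chain
rule `Δu / u = Δθ / α + |∇θ|² / α²` turns `2 κ Δθ + D |∇θ|²` into `β Δu / u`.
-/

noncomputable section

/-! ### The Levi-Civita calculus of a metric on an open set -/

namespace MetricCalculus

variable {E : Type*} [NormedAddCommGroup E] [NormedSpace ℝ E]

/-- `G` is a smooth pseudo-Riemannian metric on the open subset `U` of a vector space. -/
structure IsMetricOn (G : E → E →L[ℝ] E →L[ℝ] ℝ) (U : Set E) : Prop where
  isOpen : IsOpen U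
  contDiffOn : ContDiffOn ℝ ∞ G U
  symm : ∀ y ∈ U, ∀ v w, G y v w = G y w v
  isInvertible : ∀ y ∈ U, (G y).IsInvertible

/-- The gradient of `f` with respect to `G`. -/
def gradient (G : E → E →L[ℝ] E →L[ℝ] ℝ) (f : E → ℝ) (y : E) : E :=
  (G y).inverse (fderiv ℝ f y)

/-- The scalar product `df(grad h)` of the gradients of `f` and `h`. -/
def gradInner (G : E → E →L[ℝ] E →L[ℝ] ℝ) (f h : E → ℝ) (y : E) : ℝ :=
  fderiv ℝ f y (gradient G h y)

theorem _root_.ContDiffOn.fderiv_clm_of_isOpen {F : Type*} [NormedAddCommGroup F]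
    [NormedSpace ℝ F] {f : E → F} {U : Set E} (hf : ContDiffOn ℝ ∞ f U) (hU : IsOpen U) :
    ContDiffOn ℝ ∞ (fderiv ℝ f) U :=
  hf.fderiv_of_isOpen hU (by simp)

theorem _root_.ContDiffOn.differentiableAt_of_isOpen {F : Type*} [NormedAddCommGroup F]
    [NormedSpace ℝ F] {f : E → F} {U : Set E} (hf : ContDiffOn ℝ ∞ f U) (hU : IsOpen U)
    {y : E} (hy : y ∈ U) : DifferentiableAt ℝ f y :=
  (hf.contDiffAt (hU.mem_nhds hy)).differentiableAt (by simp)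

/-- Second derivatives are symmetric. -/
theorem fderiv_fderiv_apply_comm {f : E → ℝ} {U : Set E} (hU : IsOpen U)
    (hf : ContDiffOn ℝ ∞ f U) {y : E} (hy : y ∈ U) (u v : E) :
    fderiv ℝ (fun z => fderiv ℝ f z v) y u = fderiv ℝ (fun z => fderiv ℝ f z u) y v := by
  have h1 : DifferentiableAt ℝ (fderiv ℝ f) y :=
    (hf.fderiv_clm_of_isOpen hU).differentiableAt_of_isOpen hU hy
  have h2 := (hf.contDiffAt (hU.mem_nhds hy)).isSymmSndFDerivAt
    (by simpa using ENat.LEInfty.out)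
  rw [fderiv_clm_apply h1 (by fun_prop), fderiv_clm_apply h1 (by fun_prop)]
  simpa using h2.eq u v

namespace IsMetricOn

variable {G : E → E →L[ℝ] E →L[ℝ] ℝ} {U : Set E}

theorem differentiableAt (hG : IsMetricOn G U) {y : E} (hy : y ∈ U) : DifferentiableAt ℝ G y :=
  hG.contDiffOn.differentiableAt_of_isOpen hG.isOpen hy

theorem apply_inverse (hG : IsMetricOn G U) {y : E} (hy : y ∈ U) (a : E →L[ℝ] ℝ) (w : E) :
    G y ((G y).inverse a) w = a w := by
  rw [(hG.isInvertible y hy).self_apply_inverse]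

theorem apply_inverse' (hG : IsMetricOn G U) {y : E} (hy : y ∈ U) (a : E →L[ℝ] ℝ) (w : E) :
    G y w ((G y).inverse a) = a w := by
  rw [hG.symm y hy, hG.apply_inverse hy]

theorem ext (hG : IsMetricOn G U) {y : E} (hy : y ∈ U) {v w : E}
    (h : ∀ x, G y v x = G y w x) : v = w :=
  (hG.isInvertible y hy).injective (ContinuousLinearMap.ext h)

theorem apply_gradient (hG : IsMetricOn G U) {y : E} (hy : y ∈ U) (f : E → ℝ) (w : E) :
    G y (gradient G f y) w = fderiv ℝ f y w :=
  hG.apply_inverse hy _ w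

theorem apply_gradient' (hG : IsMetricOn G U) {y : E} (hy : y ∈ U) (f : E → ℝ) (w : E) :
    G y w (gradient G f y) = fderiv ℝ f y w :=
  hG.apply_inverse' hy _ w

theorem fderiv_apply (hG : IsMetricOn G U) {y : E} (hy : y ∈ U) (u v : E) :
    fderiv ℝ (fun z => G z v) y u = fderiv ℝ G y u v := by
  rw [fderiv_clm_apply (hG.differentiableAt hy) (by fun_prop)]
  simp

theorem fderiv_apply₂ (hG : IsMetricOn G U) {y : E} (hy : y ∈ U) (u v w : E) :
    fderiv ℝ (fun z => G z v w) y u = fderiv ℝ G y u v w := by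
  have := hG.differentiableAt hy
  rw [fderiv_clm_apply (by fun_prop) (by fun_prop)]
  simp [hG.fderiv_apply hy]

theorem fderiv_symm (hG : IsMetricOn G U) {y : E} (hy : y ∈ U) (u v w : E) :
    fderiv ℝ G y u v w = fderiv ℝ G y u w v := by
  rw [← hG.fderiv_apply₂ hy, ← hG.fderiv_apply₂ hy]
  congr 1
  apply Filter.EventuallyEq.fderiv_eq
  filter_upwards [hG.isOpen.mem_nhds hy] with z hz using hG.symm z hz v w

/-- The Koszul formula. -/
theorem apply_christoffel (hG : IsMetricOn G U) {y : E} (hy : y ∈ U) (u v w : E) :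
    G y (christoffel G y u v) w =
      1 / 2 * (fderiv ℝ G y u v w + fderiv ℝ G y v u w - fderiv ℝ G y w u v) := by
  rw [christoffel, hG.apply_inverse hy]
  simp [hG.fderiv_apply hy, hG.fderiv_apply₂ hy]

/-- The Koszul formula determines the Christoffel symbols. -/
theorem christoffel_eq (hG : IsMetricOn G U) {y : E} (hy : y ∈ U) {u v x : E}
    (h : ∀ w, G y x w =
      1 / 2 * (fderiv ℝ G y u v w + fderiv ℝ G y v u w - fderiv ℝ G y w u v)) :
    christoffel G y u v = x :=
  hG.ext hy fun w => by rw [h, hG.apply_christoffel hy]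

theorem christoffel_comm (hG : IsMetricOn G U) {y : E} (hy : y ∈ U) (u v : E) :
    christoffel G y u v = christoffel G y v u :=
  hG.christoffel_eq hy fun w => by
    rw [hG.apply_christoffel hy, hG.fderiv_symm hy w u v]; ring

/-- The Levi-Civita connection is compatible with the metric. -/
theorem fderiv_eq (hG : IsMetricOn G U) {y : E} (hy : y ∈ U) (u v w : E) :
    fderiv ℝ G y u v w = G y (christoffel G y u v) w + G y v (christoffel G y u w) := by
  rw [hG.symm y hy v, hG.apply_christoffel hy, hG.apply_christoffel hy,
    hG.fderiv_symm hy u w v, hG.fderiv_symm hy v u w, hG.fderiv_symm hy w u v]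
  ring

set_option synthInstance.maxHeartbeats 200000 in
theorem christoffel_add_left (hG : IsMetricOn G U) {y : E} (hy : y ∈ U) (u u' v : E) :
    christoffel G y (u + u') v = christoffel G y u v + christoffel G y u' v :=
  hG.christoffel_eq hy fun w => by
    simp only [map_add, add_apply, hG.apply_christoffel hy]; ring

set_option synthInstance.maxHeartbeats 200000 in
theorem christoffel_smul_left (hG : IsMetricOn G U) {y : E} (hy : y ∈ U) (c : ℝ) (u v : E) :
    christoffel G y (c • u) v = c • christoffel G y u v :=
  hG.christoffel_eq hy fun w => by
    simp only [map_smul, smul_apply, hG.apply_christoffel hy, smul_eq_mul]; ring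

theorem christoffel_add_right (hG : IsMetricOn G U) {y : E} (hy : y ∈ U) (u v v' : E) :
    christoffel G y u (v + v') = christoffel G y u v + christoffel G y u v' := by
  rw [hG.christoffel_comm hy, hG.christoffel_add_left hy, hG.christoffel_comm hy v,
    hG.christoffel_comm hy v']

theorem christoffel_smul_right (hG : IsMetricOn G U) {y : E} (hy : y ∈ U) (c : ℝ) (u v : E) :
    christoffel G y u (c • v) = c • christoffel G y u v := by
  rw [hG.christoffel_comm hy, hG.christoffel_smul_left hy, hG.christoffel_comm hy v]

theorem christoffel_sub_right (hG : IsMetricOn G U) {y : E} (hy : y ∈ U) (u v v' : E) :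
    christoffel G y u (v - v') = christoffel G y u v - christoffel G y u v' := by
  rw [sub_eq_add_neg, ← neg_one_smul ℝ v', hG.christoffel_add_right hy,
    hG.christoffel_smul_right hy, neg_one_smul, sub_eq_add_neg]

theorem fderiv_christoffel_comm (hG : IsMetricOn G U) {y : E} (hy : y ∈ U) (u v : E) :
    fderiv ℝ (fun z => christoffel G z u v) y = fderiv ℝ (fun z => christoffel G z v u) y := by
  apply Filter.EventuallyEq.fderiv_eq
  filter_upwards [hG.isOpen.mem_nhds hy] with z hz using hG.christoffel_comm hz u v

variable [FiniteDimensional ℝ E]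

theorem contDiffOn_inverse_apply (hG : IsMetricOn G U) {a : E → E →L[ℝ] ℝ}
    (ha : ContDiffOn ℝ ∞ a U) : ContDiffOn ℝ ∞ (fun z => (G z).inverse (a z)) U := by
  have : CompleteSpace E := FiniteDimensional.complete ℝ E
  refine ContDiffOn.clm_apply (fun z hz => ?_) ha
  exact (hG.isInvertible z hz).contDiffAt_map_inverse.comp_contDiffWithinAt z (hG.contDiffOn z hz)

theorem contDiffOn_gradient (hG : IsMetricOn G U) {f : E → ℝ} (hf : ContDiffOn ℝ ∞ f U) :
    ContDiffOn ℝ ∞ (gradient G f) U :=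
  hG.contDiffOn_inverse_apply (hf.fderiv_clm_of_isOpen hG.isOpen)

theorem contDiffOn_christoffel (hG : IsMetricOn G U) (u v : E) :
    ContDiffOn ℝ ∞ (fun z => christoffel G z u v) U := by
  have h : ∀ x : E, ContDiffOn ℝ ∞ (fun z => G z x) U := fun x =>
    hG.contDiffOn.clm_apply contDiffOn_const
  refine hG.contDiffOn_inverse_apply 
    (ContDiffOn.const_smul _ (ContDiffOn.sub (ContDiffOn.add ?_ ?_) ?_))
  · exact ((h v).fderiv_clm_of_isOpen hG.isOpen).clm_apply contDiffOn_const
  · exact ((h u).fderiv_clm_of_isOpen hG.isOpen).clm_apply contDiffOn_const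
  · exact ((h u).clm_apply contDiffOn_const).fderiv_clm_of_isOpen hG.isOpen

theorem differentiableAt_christoffel (hG : IsMetricOn G U) {y : E} (hy : y ∈ U) (u v : E) :
    DifferentiableAt ℝ (fun z => christoffel G z u v) y :=
  (hG.contDiffOn_christoffel u v).differentiableAt_of_isOpen hG.isOpen hy

theorem fderiv_christoffel_add_left (hG : IsMetricOn G U) {y : E} (hy : y ∈ U) (u u' v : E) :
    fderiv ℝ (fun z => christoffel G z (u + u') v) y =
      fderiv ℝ (fun z => christoffel G z u v) y + fderiv ℝ (fun z => christoffel G z u' v) y := by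
  rw [← fderiv_fun_add (hG.differentiableAt_christoffel hy u v)
    (hG.differentiableAt_christoffel hy u' v)]
  apply Filter.EventuallyEq.fderiv_eq
  filter_upwards [hG.isOpen.mem_nhds hy] with z hz using hG.christoffel_add_left hz u u' v

theorem fderiv_christoffel_smul_left (hG : IsMetricOn G U) {y : E} (hy : y ∈ U) (c : ℝ) (u v : E) :
    fderiv ℝ (fun z => christoffel G z (c • u) v) y =
      c • fderiv ℝ (fun z => christoffel G z u v) y := by
  rw [← fderiv_fun_const_smul (hG.differentiableAt_christoffel hy u v)]
  apply Filter.EventuallyEq.fderiv_eq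
  filter_upwards [hG.isOpen.mem_nhds hy] with z hz using hG.christoffel_smul_left hz c u v

theorem riemann_add₁ (hG : IsMetricOn G U) {y : E} (hy : y ∈ U) (u u' v w : E) :
    riemann G y (u + u') v w = riemann G y u v w + riemann G y u' v w := by
  simp only [riemann, map_add, add_apply, hG.christoffel_add_left hy,
    hG.christoffel_add_right hy, hG.fderiv_christoffel_add_left hy]
  abel

theorem riemann_smul₁ (hG : IsMetricOn G U) {y : E} (hy : y ∈ U) (c : ℝ) (u v w : E) :
    riemann G y (c • u) v w = c • riemann G y u v w := by
  simp only [riemann, map_smul, smul_apply, hG.christoffel_smul_left hy,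
    hG.christoffel_smul_right hy, hG.fderiv_christoffel_smul_left hy]
  module

theorem riemann_add₂ (hG : IsMetricOn G U) {y : E} (hy : y ∈ U) (u v v' w : E) :
    riemann G y u (v + v') w = riemann G y u v w + riemann G y u v' w := by
  simp only [riemann, map_add, add_apply, hG.christoffel_add_left hy,
    hG.christoffel_add_right hy, hG.fderiv_christoffel_add_left hy]
  abel

theorem riemann_smul₂ (hG : IsMetricOn G U) {y : E} (hy : y ∈ U) (c : ℝ) (u v w : E) :
    riemann G y u (c • v) w = c • riemann G y u v w := by
  simp only [riemann, map_smul, smul_apply, hG.christoffel_smul_left hy,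
    hG.christoffel_smul_right hy, hG.fderiv_christoffel_smul_left hy]
  module

theorem riemann_add₃ (hG : IsMetricOn G U) {y : E} (hy : y ∈ U) (u v w w' : E) :
    riemann G y u v (w + w') = riemann G y u v w + riemann G y u v w' := by
  simp only [riemann, hG.fderiv_christoffel_comm hy _ (w + w'), hG.fderiv_christoffel_comm hy _ w,
    hG.fderiv_christoffel_comm hy _ w', add_apply,
    hG.christoffel_add_right hy, hG.fderiv_christoffel_add_left hy]
  abel

theorem riemann_smul₃ (hG : IsMetricOn G U) {y : E} (hy : y ∈ U) (c : ℝ) (u v w : E) :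
    riemann G y u v (c • w) = c • riemann G y u v w := by
  simp only [riemann, hG.fderiv_christoffel_comm hy _ (c • w), hG.fderiv_christoffel_comm hy _ w,
    smul_apply, hG.christoffel_smul_right hy, hG.fderiv_christoffel_smul_left hy]
  module

end IsMetricOn

end MetricCalculus

/-! ### Traces -/

namespace MetricCalculus

variable {E : Type*} [NormedAddCommGroup E] [NormedSpace ℝ E] [FiniteDimensional ℝ E]

/-- The trace of an endomorphism, as the sum of its diagonal entries in the standard basis; it is
defined for arbitrary maps so that it can be computed without bundling them. -/
def basisTrace (A : E → E) : ℝ :=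
  ∑ i, (Module.finBasis ℝ E).coord i (A (Module.finBasis ℝ E i))

theorem ricci_eq_basisTrace (G : E → E →L[ℝ] E →L[ℝ] ℝ) (y v w : E) :
    ricci G y v w = basisTrace fun u => riemann G y u v w := rfl

theorem basisTrace_eq_trace (A : E →ₗ[ℝ] E) : basisTrace A = LinearMap.trace ℝ E A := by
  rw [LinearMap.trace_eq_matrix_trace ℝ (Module.finBasis ℝ E), Matrix.trace]
  simp [basisTrace, LinearMap.toMatrix_apply]

theorem basisTrace_add (A A' : E → E) :
    basisTrace (fun u => A u + A' u) = basisTrace A + basisTrace A' := by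
  simp [basisTrace, Finset.sum_add_distrib]

theorem basisTrace_sub (A A' : E → E) :
    basisTrace (fun u => A u - A' u) = basisTrace A - basisTrace A' := by
  simp [basisTrace, Finset.sum_sub_distrib]

theorem basisTrace_const_smul (c : ℝ) (A : E → E) :
    basisTrace (fun u => c • A u) = c * basisTrace A := by
  simp [basisTrace, Finset.mul_sum]

theorem basisTrace_id : basisTrace (fun u : E => u) = Module.finrank ℝ E := by
  simp [basisTrace]

theorem basisTrace_smul_id (c : ℝ) :
    basisTrace (fun u : E => c • u) = c * Module.finrank ℝ E := by
  rw [basisTrace_const_smul, basisTrace_id]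

theorem basisTrace_smul_const (l : E →ₗ[ℝ] ℝ) (x : E) :
    basisTrace (fun u => l u • x) = l x := by
  conv_rhs => rw [← (Module.finBasis ℝ E).sum_repr x]
  simp only [basisTrace, map_sum, map_smul, Module.Basis.coord_apply, smul_eq_mul]
  exact Finset.sum_congr rfl fun i _ => mul_comm _ _

variable {G : E → E →L[ℝ] E →L[ℝ] ℝ} {U : Set E} {y : E}

theorem metricTrace_add (S T : E → E → ℝ) :
    metricTrace G y (fun u v => S u v + T u v) = metricTrace G y S + metricTrace G y T := by
  simp [metricTrace, Finset.sum_add_distrib]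

theorem metricTrace_sub (S T : E → E → ℝ) :
    metricTrace G y (fun u v => S u v - T u v) = metricTrace G y S - metricTrace G y T := by
  simp [metricTrace, Finset.sum_sub_distrib]

theorem metricTrace_const_mul (c : ℝ) (T : E → E → ℝ) :
    metricTrace G y (fun u v => c * T u v) = c * metricTrace G y T := by
  simp [metricTrace, Finset.mul_sum]

namespace IsMetricOn

/-- The metric trace of a bilinear form is the trace of the endomorphism obtained by raising an
index. -/
theorem metricTrace_eq_basisTrace (hG : IsMetricOn G U) (hy : y ∈ U) {T : E → E → ℝ} {A : E → E}
    (h : ∀ u v, T u v = G y (A u) v) : metricTrace G y T = basisTrace A := by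
  simp only [metricTrace, basisTrace, h, hG.apply_inverse' hy]
  simp

theorem metricTrace_self (hG : IsMetricOn G U) (hy : y ∈ U) :
    metricTrace G y (fun u v => G y u v) = Module.finrank ℝ E := by
  rw [hG.metricTrace_eq_basisTrace hy (A := fun u => u) fun _ _ => rfl, basisTrace_id]

theorem metricTrace_fderiv_mul_fderiv (hG : IsMetricOn G U) (hy : y ∈ U) (f h : E → ℝ) :
    metricTrace G y (fun u v => fderiv ℝ f y u * fderiv ℝ h y v) = gradInner G f h y := by
  rw [hG.metricTrace_eq_basisTrace hy (A := fun u => fderiv ℝ f y u • gradient G h y) fun u v => by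
    simp [hG.apply_gradient hy]]
  exact basisTrace_smul_const (fderiv ℝ f y : E →ₗ[ℝ] ℝ) _

omit [FiniteDimensional ℝ E] in
theorem gradInner_comm (hG : IsMetricOn G U) (hy : y ∈ U) (f h : E → ℝ) :
    gradInner G f h y = gradInner G h f y := by
  rw [gradInner, gradInner, ← hG.apply_gradient hy, hG.apply_gradient' hy]

end IsMetricOn

/-! ### The Hessian as an endomorphism -/

/-- The covariant derivative `∇_u (grad f)`. -/
def hessianEnd (G : E → E →L[ℝ] E →L[ℝ] ℝ) (f : E → ℝ) (y u : E) : E :=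
  fderiv ℝ (gradient G f) y u + christoffel G y u (gradient G f y)

namespace IsMetricOn

variable {f : E → ℝ}

theorem differentiableAt_gradient (hG : IsMetricOn G U) (hf : ContDiffOn ℝ ∞ f U) (hy : y ∈ U) :
    DifferentiableAt ℝ (gradient G f) y :=
  (hG.contDiffOn_gradient hf).differentiableAt_of_isOpen hG.isOpen hy

/-- Differentiating `G(grad f, v) = df(v)` shows that `u ↦ ∇_u (grad f)` represents the Hessian. -/
theorem apply_hessianEnd (hG : IsMetricOn G U) (hf : ContDiffOn ℝ ∞ f U) (hy : y ∈ U) (u v : E) :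
    G y (hessianEnd G f y u) v = hessian G f y u v := by
  have hN := hG.differentiableAt_gradient hf hy
  have hGd := hG.differentiableAt hy
  have h1 : fderiv ℝ (fun z => G z (gradient G f z) v) y u =
      fderiv ℝ (fun z => fderiv ℝ f z v) y u := by
    congr 1
    apply Filter.EventuallyEq.fderiv_eq
    filter_upwards [hG.isOpen.mem_nhds hy] with z hz using hG.apply_gradient hz f v
  have h2 : fderiv ℝ (fun z => G z (gradient G f z) v) y u =
      fderiv ℝ G y u (gradient G f y) v + G y (fderiv ℝ (gradient G f) y u) v := by
    rw [fderiv_clm_apply (hGd.clm_apply hN) (by fun_prop), fderiv_clm_apply hGd hN]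
    simp [add_comm]
  rw [h1, hG.fderiv_eq hy, hG.symm y hy (gradient G f y), hG.apply_gradient' hy] at h2
  rw [hessian, h2, hessianEnd]
  simp only [map_add, add_apply]
  ring

omit [FiniteDimensional ℝ E] in
theorem hessianEnd_add (hG : IsMetricOn G U) (hy : y ∈ U) (u u' : E) :
    hessianEnd G f y (u + u') = hessianEnd G f y u + hessianEnd G f y u' := by
  simp only [hessianEnd, map_add, hG.christoffel_add_left hy]
  abel

omit [FiniteDimensional ℝ E] in
theorem hessianEnd_smul (hG : IsMetricOn G U) (hy : y ∈ U) (c : ℝ) (u : E) :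
    hessianEnd G f y (c • u) = c • hessianEnd G f y u := by
  simp only [hessianEnd, map_smul, hG.christoffel_smul_left hy, smul_add]

theorem laplacian_eq_basisTrace (hG : IsMetricOn G U) (hf : ContDiffOn ℝ ∞ f U) (hy : y ∈ U) :
    laplacian G f y = basisTrace (hessianEnd G f y) :=
  hG.metricTrace_eq_basisTrace hy fun u v => (hG.apply_hessianEnd hf hy u v).symm

end IsMetricOn

/-! ### Conformal changes -/

theorem isInvertible_of_nondegenerate {A : E →L[ℝ] E →L[ℝ] ℝ}
    (h : ∀ v, (∀ w, A v w = 0) → v = 0) : A.IsInvertible := by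
  have hinj : Function.Injective (A : E →ₗ[ℝ] E →L[ℝ] ℝ) :=
    (injective_iff_map_eq_zero _).2 fun v hv => h v fun w => by
      simpa using congrArg (fun a : E →L[ℝ] ℝ => a w) hv
  have hdim : Module.finrank ℝ E = Module.finrank ℝ (E →L[ℝ] ℝ) := by
    rw [← (LinearMap.toContinuousLinearMap (𝕜 := ℝ) (E := E) (F' := ℝ)).finrank_eq]
    exact Subspace.dual_finrank_eq.symm
  exact ⟨(LinearEquiv.ofInjectiveOfFinrankEq _ hinj hdim).toContinuousLinearEquiv, by ext; rfl⟩

omit [FiniteDimensional ℝ E] in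
/-- Instance search does not find `IsBoundedSMul` on spaces of bilinear maps, so `ContDiffOn.smul`
has to be specialized to an abstract normed space first. -/
theorem _root_.ContDiffOn.smul_of_normedSpace {V : Type*} [NormedAddCommGroup V]
    [NormedSpace ℝ V] {c : E → ℝ} {s : E → V} (hc : ContDiffOn ℝ ∞ c U)
    (hs : ContDiffOn ℝ ∞ s U) : ContDiffOn ℝ ∞ (fun z => c z • s z) U :=
  hc.smul hs

/-- The conformal metric `e^{2φ} G`. -/
def conformal (φ : E → ℝ) (G : E → E →L[ℝ] E →L[ℝ] ℝ) (z : E) : E →L[ℝ] E →L[ℝ] ℝ :=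
  Real.exp (2 * φ z) • G z

/-- The difference of the Levi-Civita connections of `e^{2φ} G` and `G`. -/
def conformalDiff (φ : E → ℝ) (G : E → E →L[ℝ] E →L[ℝ] ℝ) (z u v : E) : E :=
  fderiv ℝ φ z u • v + fderiv ℝ φ z v • u - G z u v • gradient G φ z

namespace IsMetricOn

variable {φ f : E → ℝ}

set_option synthInstance.maxHeartbeats 200000 in
theorem conformal (hG : IsMetricOn G U) (hφ : ContDiffOn ℝ ∞ φ U) :
    IsMetricOn (conformal φ G) U where
  isOpen := hG.isOpen
  contDiffOn := (contDiffOn_const.mul hφ).exp.smul_of_normedSpace hG.contDiffOn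
  symm y hy v w := by simp [MetricCalculus.conformal, hG.symm y hy v w]
  isInvertible y hy := by
    refine isInvertible_of_nondegenerate fun v hv => hG.ext hy fun w => ?_
    simpa [MetricCalculus.conformal] using hv w

theorem inverse_conformal (hG : IsMetricOn G U) (hφ : ContDiffOn ℝ ∞ φ U) (hy : y ∈ U)
    (a : E →L[ℝ] ℝ) :
    (MetricCalculus.conformal φ G y).inverse a = Real.exp (-(2 * φ y)) • (G y).inverse a := by
  refine (hG.conformal hφ).ext hy fun w => ?_
  rw [(hG.conformal hφ).apply_inverse hy]
  simp only [MetricCalculus.conformal, smul_apply, map_smul, smul_eq_mul]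
  rw [hG.apply_inverse hy, ← mul_assoc, ← Real.exp_add]
  simp

/-- Only homogeneity in the second slot matters, where `metricTrace` inserts the vectors with
raised indices. -/
theorem metricTrace_conformal (hG : IsMetricOn G U) (hφ : ContDiffOn ℝ ∞ φ U) (hy : y ∈ U)
    {T : E → E → ℝ} (hT : ∀ (c : ℝ) u v, T u (c • v) = c * T u v) :
    metricTrace (MetricCalculus.conformal φ G) y T = Real.exp (-(2 * φ y)) * metricTrace G y T := by
  simp only [metricTrace, hG.inverse_conformal hφ hy, hT, Finset.mul_sum]

theorem gradInner_conformal (hG : IsMetricOn G U) (hφ : ContDiffOn ℝ ∞ φ U) (hy : y ∈ U)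
    (f h : E → ℝ) : gradInner (MetricCalculus.conformal φ G) f h y =
      Real.exp (-(2 * φ y)) * gradInner G f h y := by
  simp only [gradInner, gradient, hG.inverse_conformal hφ hy, map_smul, smul_eq_mul]

set_option synthInstance.maxHeartbeats 200000 in
theorem fderiv_conformal (hG : IsMetricOn G U) (hφ : ContDiffOn ℝ ∞ φ U) (hy : y ∈ U) (u v w : E) :
    fderiv ℝ (MetricCalculus.conformal φ G) y u v w =
      Real.exp (2 * φ y) * (2 * fderiv ℝ φ y u * G y v w + fderiv ℝ G y u v w) := by
  have h1 : DifferentiableAt ℝ φ y := hφ.differentiableAt_of_isOpen hG.isOpen hy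
  have h2 : DifferentiableAt ℝ (fun z => G z v w) y :=
    ((hG.differentiableAt hy).clm_apply (by fun_prop)).clm_apply (by fun_prop)
  rw [← (hG.conformal hφ).fderiv_apply₂ hy, ← hG.fderiv_apply₂ hy]
  have h3 : (fun z => MetricCalculus.conformal φ G z v w) =
      fun z => Real.exp (2 * φ z) * G z v w := rfl
  rw [h3, fderiv_fun_mul (by fun_prop) h2, fderiv_exp (by fun_prop), fderiv_const_mul h1]
  simp only [add_apply, smul_apply, smul_eq_mul]
  ring

/-- The Levi-Civita connection of a conformal metric, by checking the Koszul formula. -/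
theorem christoffel_conformal (hG : IsMetricOn G U) (hφ : ContDiffOn ℝ ∞ φ U) (hy : y ∈ U)
    (u v : E) : christoffel (MetricCalculus.conformal φ G) y u v =
      christoffel G y u v + conformalDiff φ G y u v := by
  refine (hG.conformal hφ).christoffel_eq hy fun w => ?_
  simp only [hG.fderiv_conformal hφ hy, MetricCalculus.conformal, smul_apply, conformalDiff,
    map_add, map_sub, map_smul, add_apply, _root_.sub_apply, smul_eq_mul]
  rw [hG.apply_christoffel hy, hG.apply_gradient hy]
  ring

theorem hessian_conformal (hG : IsMetricOn G U) (hφ : ContDiffOn ℝ ∞ φ U) (hy : y ∈ U)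
    (u v : E) : hessian (MetricCalculus.conformal φ G) f y u v =
      hessian G f y u v - fderiv ℝ φ y u * fderiv ℝ f y v - fderiv ℝ f y u * fderiv ℝ φ y v
        + gradInner G f φ y * G y u v := by
  rw [hessian, hG.christoffel_conformal hφ hy, hessian, conformalDiff, gradInner]
  simp only [map_add, map_sub, map_smul, smul_eq_mul]
  ring

theorem hessian_smul_right (hG : IsMetricOn G U) (hf : ContDiffOn ℝ ∞ f U) (hy : y ∈ U)
    (c : ℝ) (u v : E) : hessian G f y u (c • v) = c * hessian G f y u v := by
  rw [← hG.apply_hessianEnd hf hy, map_smul, hG.apply_hessianEnd hf hy, smul_eq_mul]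

theorem laplacian_conformal (hG : IsMetricOn G U) (hφ : ContDiffOn ℝ ∞ φ U)
    (hf : ContDiffOn ℝ ∞ f U) (hy : y ∈ U) :
    laplacian (MetricCalculus.conformal φ G) f y = Real.exp (-(2 * φ y)) *
      (laplacian G f y + (Module.finrank ℝ E - 2) * gradInner G f φ y) := by
  rw [laplacian, hG.metricTrace_conformal hφ hy
    fun c u v => (hG.conformal hφ).hessian_smul_right hf hy c u v]
  congr 1
  have h : hessian (MetricCalculus.conformal φ G) f y = fun u v =>
      hessian G f y u v - fderiv ℝ φ y u * fderiv ℝ f y v - fderiv ℝ f y u * fderiv ℝ φ y v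
        + gradInner G f φ y * G y u v := by
    ext u v; exact hG.hessian_conformal hφ hy u v
  rw [h, metricTrace_add, metricTrace_sub, metricTrace_sub, metricTrace_const_mul,
    hG.metricTrace_self hy, hG.metricTrace_fderiv_mul_fderiv hy,
    hG.metricTrace_fderiv_mul_fderiv hy, hG.gradInner_comm hy φ f, laplacian]
  ring

/-- The derivative of the difference tensor, in constant directions `v`, `w`. -/
theorem hasFDerivAt_conformalDiff (hG : IsMetricOn G U) (hφ : ContDiffOn ℝ ∞ φ U) (hy : y ∈ U)
    (v w : E) : ∃ L : E →L[ℝ] E, HasFDerivAt (fun z => conformalDiff φ G z v w) L y ∧ ∀ u, L u =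
      fderiv ℝ (fun z => fderiv ℝ φ z v) y u • w + fderiv ℝ (fun z => fderiv ℝ φ z w) y u • v
        - (G y v w • fderiv ℝ (gradient G φ) y u + fderiv ℝ G y u v w • gradient G φ y) := by
  have h1 : DifferentiableAt ℝ (fderiv ℝ φ) y :=
    (hφ.fderiv_clm_of_isOpen hG.isOpen).differentiableAt_of_isOpen hG.isOpen hy
  have h1' : ∀ x, DifferentiableAt ℝ (fun z => fderiv ℝ φ z x) y := fun x =>
    h1.clm_apply (by fun_prop)
  have h2 : DifferentiableAt ℝ (fun z => G z v w) y :=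
    ((hG.differentiableAt hy).clm_apply (by fun_prop)).clm_apply (by fun_prop)
  have h3 := hG.differentiableAt_gradient hφ hy
  refine ⟨_, (((h1' v).hasFDerivAt.smul_const w).add ((h1' w).hasFDerivAt.smul_const v)).sub
    (h2.hasFDerivAt.smul h3.hasFDerivAt), fun u => ?_⟩
  simp only [add_apply, _root_.sub_apply, smul_apply, ContinuousLinearMap.smulRight_apply,
    hG.fderiv_apply₂ hy]

theorem fderiv_christoffel_conformal (hG : IsMetricOn G U) (hφ : ContDiffOn ℝ ∞ φ U)
    (hy : y ∈ U) (u v w : E) :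
    fderiv ℝ (fun z => christoffel (MetricCalculus.conformal φ G) z v w) y u =
      fderiv ℝ (fun z => christoffel G z v w) y u +
      (fderiv ℝ (fun z => fderiv ℝ φ z v) y u • w + fderiv ℝ (fun z => fderiv ℝ φ z w) y u • v
        - (G y v w • fderiv ℝ (gradient G φ) y u + fderiv ℝ G y u v w • gradient G φ y)) := by
  have h : (fun z => christoffel (MetricCalculus.conformal φ G) z v w) =ᶠ[𝓝 y]
      fun z => christoffel G z v w + conformalDiff φ G z v w := by
    filter_upwards [hG.isOpen.mem_nhds hy] with z hz using hG.christoffel_conformal hφ hz v w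
  obtain ⟨L, hL, hL'⟩ := hG.hasFDerivAt_conformalDiff hφ hy v w
  rw [h.fderiv_eq, fderiv_fun_add (hG.differentiableAt_christoffel hy v w) hL.differentiableAt,
    hL.fderiv, add_apply, hL']

/-- The curvature of a conformal metric. -/
theorem riemann_conformal (hG : IsMetricOn G U) (hφ : ContDiffOn ℝ ∞ φ U) (hy : y ∈ U)
    (u v w : E) : riemann (MetricCalculus.conformal φ G) y u v w =
      riemann G y u v w + hessian G φ y u w • v - hessian G φ y v w • u
        - G y v w • hessianEnd G φ y u + G y u w • hessianEnd G φ y v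
        + (fderiv ℝ φ y v * fderiv ℝ φ y w) • u - (fderiv ℝ φ y u * fderiv ℝ φ y w) • v
        - (gradInner G φ φ y * G y v w) • u + (gradInner G φ φ y * G y u w) • v
        - (fderiv ℝ φ y v * G y u w) • gradient G φ y
        + (fderiv ℝ φ y u * G y v w) • gradient G φ y := by
  simp only [riemann, hG.fderiv_christoffel_conformal hφ hy, hG.christoffel_conformal hφ hy]
  -- The terms symmetric in `u` and `v` cancel, and Christoffel symbols combine with second
  -- derivatives of `φ` into Hessians.
  rw [fderiv_fderiv_apply_comm hG.isOpen hφ hy v u]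
  simp only [conformalDiff, hessianEnd, hessian, hG.christoffel_add_right hy,
    hG.christoffel_sub_right hy, hG.christoffel_smul_right hy, hG.fderiv_eq hy,
    map_add, map_sub, map_smul, smul_eq_mul, hG.apply_gradient' hy, gradInner]
  rw [hG.christoffel_comm hy v u, hG.symm y hy u v, hG.symm y hy (christoffel G y u v) w]
  module

/-- The Ricci tensor of a conformal metric, by tracing `riemann_conformal` term by term. -/
theorem ricci_conformal (hG : IsMetricOn G U) (hφ : ContDiffOn ℝ ∞ φ U) (hy : y ∈ U)
    (v w : E) : ricci (MetricCalculus.conformal φ G) y v w =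
      ricci G y v w + (2 - Module.finrank ℝ E) * hessian G φ y v w - laplacian G φ y * G y v w
        + (Module.finrank ℝ E - 2) * (fderiv ℝ φ y v * fderiv ℝ φ y w)
        + ((2 - Module.finrank ℝ E) * gradInner G φ φ y) * G y v w := by
  have hp : ∀ x, basisTrace (fun u => fderiv ℝ φ y u • x) = fderiv ℝ φ y x := fun x =>
    basisTrace_smul_const (fderiv ℝ φ y : E →ₗ[ℝ] ℝ) x
  have hg : ∀ x, basisTrace (fun u => G y u w • x) = G y x w := fun x => by
    simp only [hG.symm y hy _ w]
    exact basisTrace_smul_const (G y w : E →ₗ[ℝ] ℝ) x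
  have hh : ∀ x, basisTrace (fun u => hessian G φ y u w • x) = hessian G φ y x w := fun x =>
    basisTrace_smul_const
      (IsLinearMap.mk' (fun u => hessian G φ y u w)
        ⟨fun a b => by simp only [← hG.apply_hessianEnd hφ hy, hG.hessianEnd_add hy, map_add,
          add_apply],
         fun c a => by simp only [← hG.apply_hessianEnd hφ hy, hG.hessianEnd_smul hy, map_smul,
          smul_apply]⟩) x
  have e : (fun u => riemann (MetricCalculus.conformal φ G) y u v w) = fun u =>
      riemann G y u v w + hessian G φ y u w • v - hessian G φ y v w • u
        - G y v w • hessianEnd G φ y u + G y u w • hessianEnd G φ y v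
        + (fderiv ℝ φ y v * fderiv ℝ φ y w) • u - fderiv ℝ φ y w • (fderiv ℝ φ y u • v)
        - (gradInner G φ φ y * G y v w) • u + gradInner G φ φ y • (G y u w • v)
        - fderiv ℝ φ y v • (G y u w • gradient G φ y)
        + G y v w • (fderiv ℝ φ y u • gradient G φ y) := by
    ext u
    rw [hG.riemann_conformal hφ hy]
    module
  rw [ricci_eq_basisTrace, e]
  simp only [basisTrace_add, basisTrace_sub, basisTrace_smul_id, basisTrace_const_smul, hp, hg, hh,
    hG.apply_hessianEnd hφ hy, hG.apply_gradient hy]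
  rw [← hG.laplacian_eq_basisTrace hφ hy, ← ricci_eq_basisTrace]
  have : fderiv ℝ φ y (gradient G φ y) = gradInner G φ φ y := rfl
  rw [this]
  ring

theorem ricci_add_left (hG : IsMetricOn G U) (hy : y ∈ U) (v v' w : E) :
    ricci G y (v + v') w = ricci G y v w + ricci G y v' w := by
  simp only [ricci_eq_basisTrace, hG.riemann_add₂ hy, basisTrace_add]

theorem ricci_smul_left (hG : IsMetricOn G U) (hy : y ∈ U) (c : ℝ) (v w : E) :
    ricci G y (c • v) w = c * ricci G y v w := by
  simp only [ricci_eq_basisTrace, hG.riemann_smul₂ hy, basisTrace_const_smul]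

theorem ricci_add_right (hG : IsMetricOn G U) (hy : y ∈ U) (v w w' : E) :
    ricci G y v (w + w') = ricci G y v w + ricci G y v w' := by
  simp only [ricci_eq_basisTrace, hG.riemann_add₃ hy, basisTrace_add]

theorem ricci_smul_right (hG : IsMetricOn G U) (hy : y ∈ U) (c : ℝ) (v w : E) :
    ricci G y v (c • w) = c * ricci G y v w := by
  simp only [ricci_eq_basisTrace, hG.riemann_smul₃ hy, basisTrace_const_smul]

/-- The scalar curvature of a conformal metric. -/
theorem scalarCurvature_conformal (hG : IsMetricOn G U) (hφ : ContDiffOn ℝ ∞ φ U) (hy : y ∈ U) :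
    scalarCurvature (MetricCalculus.conformal φ G) y = Real.exp (-(2 * φ y)) *
      (scalarCurvature G y - 2 * (Module.finrank ℝ E - 1) * laplacian G φ y
        - (Module.finrank ℝ E - 2) * (Module.finrank ℝ E - 1) * gradInner G φ φ y) := by
  rw [scalarCurvature, hG.metricTrace_conformal hφ hy
    fun c u v => (hG.conformal hφ).ricci_smul_right hy c u v]
  congr 1
  have h : ricci (MetricCalculus.conformal φ G) y = fun v w =>
      ricci G y v w + (2 - Module.finrank ℝ E) * hessian G φ y v w - laplacian G φ y * G y v w
        + (Module.finrank ℝ E - 2) * (fderiv ℝ φ y v * fderiv ℝ φ y w)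
        + ((2 - Module.finrank ℝ E) * gradInner G φ φ y) * G y v w := by
    ext v w; exact hG.ricci_conformal hφ hy v w
  rw [h]
  simp only [metricTrace_add, metricTrace_sub, metricTrace_const_mul, hG.metricTrace_self hy,
    hG.metricTrace_fderiv_mul_fderiv hy]
  rw [scalarCurvature, laplacian]
  ring

end IsMetricOn

end MetricCalculus

/-! ### Direct products -/

namespace MetricCalculus

section Product

variable {E : Type*} [NormedAddCommGroup E] [NormedSpace ℝ E] [FiniteDimensional ℝ E]
  {F : Type*} [NormedAddCommGroup F] [NormedSpace ℝ F] [FiniteDimensional ℝ F]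

/-- The direct product of two metrics. -/
def prodMetric (GE : E → E →L[ℝ] E →L[ℝ] ℝ) (GF : F → F →L[ℝ] F →L[ℝ] ℝ) (z : E × F) :
    (E × F) →L[ℝ] (E × F) →L[ℝ] ℝ :=
  (GE z.1).bilinearComp (.fst ℝ E F) (.fst ℝ E F) + (GF z.2).bilinearComp (.snd ℝ E F) (.snd ℝ E F)

omit [FiniteDimensional ℝ E] [FiniteDimensional ℝ F] in
theorem prodMetric_apply (GE : E → E →L[ℝ] E →L[ℝ] ℝ) (GF : F → F →L[ℝ] F →L[ℝ] ℝ)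
    (z v w : E × F) : prodMetric GE GF z v w = GE z.1 v.1 w.1 + GF z.2 v.2 w.2 := rfl

/-- Pulling back bilinear forms along a fixed linear map is a smooth operation. -/
theorem _root_.ContDiffOn.bilinearComp_const {X V W : Type*} [NormedAddCommGroup X]
    [NormedSpace ℝ X] [NormedAddCommGroup V] [NormedSpace ℝ V] [NormedAddCommGroup W]
    [NormedSpace ℝ W] {s : Set X} {A : X → V →L[ℝ] V →L[ℝ] ℝ} (hA : ContDiffOn ℝ ∞ A s)
    (D : W →L[ℝ] V) : ContDiffOn ℝ ∞ (fun z => (A z).bilinearComp D D) s := by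
  have h : ContDiffOn ℝ ∞ (fun z => ((ContinuousLinearMap.compL ℝ W V ℝ).flip D) ∘L
      (A z ∘L D)) s :=
    contDiffOn_const.clm_comp (hA.clm_comp contDiffOn_const)
  exact h

namespace IsMetricOn

variable {GE : E → E →L[ℝ] E →L[ℝ] ℝ} {GF : F → F →L[ℝ] F →L[ℝ] ℝ} {U : Set E} {V : Set F}
  {f h : E → ℝ} {z : E × F}

theorem prod (hE : IsMetricOn GE U) (hF : IsMetricOn GF V) :
    IsMetricOn (prodMetric GE GF) (U ×ˢ V) where
  isOpen := hE.isOpen.prod hF.isOpen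
  contDiffOn :=
    ((hE.contDiffOn.comp contDiffOn_fst fun _ hz => hz.1).bilinearComp_const _).add
      ((hF.contDiffOn.comp contDiffOn_snd fun _ hz => hz.2).bilinearComp_const _)
  symm z hz v w := by
    rw [prodMetric_apply, prodMetric_apply, hE.symm _ hz.1, hF.symm _ hz.2]
  isInvertible z hz := by
    refine isInvertible_of_nondegenerate fun v hv =>
      Prod.ext (hE.ext hz.1 fun w => ?_) (hF.ext hz.2 fun w => ?_)
    · simpa [prodMetric_apply] using hv (w, 0)
    · simpa [prodMetric_apply] using hv (0, w)

theorem fderiv_prodMetric (hE : IsMetricOn GE U) (hF : IsMetricOn GF V) (hz : z ∈ U ×ˢ V)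
    (u v w : E × F) : fderiv ℝ (prodMetric GE GF) z u v w =
      fderiv ℝ GE z.1 u.1 v.1 w.1 + fderiv ℝ GF z.2 u.2 v.2 w.2 := by
  rw [← (hE.prod hF).fderiv_apply₂ hz, ← hE.fderiv_apply₂ hz.1, ← hF.fderiv_apply₂ hz.2]
  have h1 : DifferentiableAt ℝ (fun x => GE x v.1 w.1) z.1 :=
    ((hE.differentiableAt hz.1).clm_apply (by fun_prop)).clm_apply (by fun_prop)
  have h2 : DifferentiableAt ℝ (fun x => GF x v.2 w.2) z.2 :=
    ((hF.differentiableAt hz.2).clm_apply (by fun_prop)).clm_apply (by fun_prop)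
  have h3 : HasFDerivAt (fun x => prodMetric GE GF x v w) _ z :=
    (h1.hasFDerivAt.comp z hasFDerivAt_fst).add (h2.hasFDerivAt.comp z hasFDerivAt_snd)
  rw [h3.fderiv]
  rfl

theorem christoffel_prod (hE : IsMetricOn GE U) (hF : IsMetricOn GF V) (hz : z ∈ U ×ˢ V)
    (u v : E × F) : christoffel (prodMetric GE GF) z u v =
      (christoffel GE z.1 u.1 v.1, christoffel GF z.2 u.2 v.2) := by
  refine (hE.prod hF).christoffel_eq hz fun w => ?_
  rw [prodMetric_apply, hE.apply_christoffel hz.1, hF.apply_christoffel hz.2]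
  simp only [hE.fderiv_prodMetric hF hz]
  ring

theorem riemann_prod (hE : IsMetricOn GE U) (hF : IsMetricOn GF V) (hz : z ∈ U ×ˢ V)
    (u v w : E × F) : riemann (prodMetric GE GF) z u v w =
      (riemann GE z.1 u.1 v.1 w.1, riemann GF z.2 u.2 v.2 w.2) := by
  have hd : ∀ a b c : E × F, fderiv ℝ (fun x => christoffel (prodMetric GE GF) x a b) z c =
      (fderiv ℝ (fun x => christoffel GE x a.1 b.1) z.1 c.1,
        fderiv ℝ (fun x => christoffel GF x a.2 b.2) z.2 c.2) := by
    intro a b c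
    have h0 : (fun x => christoffel (prodMetric GE GF) x a b) =ᶠ[𝓝 z]
        fun x => (christoffel GE x.1 a.1 b.1, christoffel GF x.2 a.2 b.2) := by
      filter_upwards [(hE.prod hF).isOpen.mem_nhds hz] with x hx using
        hE.christoffel_prod hF hx a b
    have h1 : HasFDerivAt (fun x : E × F =>
        (christoffel GE x.1 a.1 b.1, christoffel GF x.2 a.2 b.2)) _ z :=
      ((hE.differentiableAt_christoffel hz.1 a.1 b.1).hasFDerivAt.comp z hasFDerivAt_fst).prodMk
        ((hF.differentiableAt_christoffel hz.2 a.2 b.2).hasFDerivAt.comp z hasFDerivAt_snd)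
    rw [h0.fderiv_eq, h1.fderiv]
    rfl
  simp only [riemann, hd, hE.christoffel_prod hF hz]
  rfl

/-- The trace defining the Ricci tensor is taken in a basis of `E × F` unrelated to those of the
factors, so this needs the linearity of the curvature. -/
theorem ricci_prod (hE : IsMetricOn GE U) (hF : IsMetricOn GF V) (hz : z ∈ U ×ˢ V)
    (v w : E × F) : ricci (prodMetric GE GF) z v w =
      ricci GE z.1 v.1 w.1 + ricci GF z.2 v.2 w.2 := by
  let RE : E →ₗ[ℝ] E := IsLinearMap.mk' (fun u => riemann GE z.1 u v.1 w.1)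
    ⟨fun a b => hE.riemann_add₁ hz.1 a b _ _, fun c a => hE.riemann_smul₁ hz.1 c a _ _⟩
  let RF : F →ₗ[ℝ] F := IsLinearMap.mk' (fun u => riemann GF z.2 u v.2 w.2)
    ⟨fun a b => hF.riemann_add₁ hz.2 a b _ _, fun c a => hF.riemann_smul₁ hz.2 c a _ _⟩
  have h : (fun u => riemann (prodMetric GE GF) z u v w) = RE.prodMap RF := by
    ext1 u
    exact hE.riemann_prod hF hz u v w
  rw [ricci_eq_basisTrace, h, basisTrace_eq_trace, LinearMap.trace_prodMap',
    ← basisTrace_eq_trace, ← basisTrace_eq_trace]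
  rfl

/-- A trace with respect to a product metric splits. -/
theorem metricTrace_prod (hE : IsMetricOn GE U) (hF : IsMetricOn GF V) (hz : z ∈ U ×ˢ V)
    {T : E × F → E × F → ℝ} (AE : E →ₗ[ℝ] E) (AF : F →ₗ[ℝ] F)
    (hT : ∀ v w, T v w = GE z.1 (AE v.1) w.1 + GF z.2 (AF v.2) w.2) :
    metricTrace (prodMetric GE GF) z T = basisTrace AE + basisTrace AF := by
  rw [(hE.prod hF).metricTrace_eq_basisTrace hz (A := AE.prodMap AF) hT, basisTrace_eq_trace,
    LinearMap.trace_prodMap', ← basisTrace_eq_trace, ← basisTrace_eq_trace]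

/-- The Ricci tensor with an index raised. -/
theorem exists_ricciEnd (hE : IsMetricOn GE U) {y : E} (hy : y ∈ U) :
    ∃ A : E →ₗ[ℝ] E, ∀ v w, ricci GE y v w = GE y (A v) w := by
  let R : E →ₗ[ℝ] E →ₗ[ℝ] ℝ := LinearMap.mk₂ ℝ (ricci GE y) (hE.ricci_add_left hy)
    (hE.ricci_smul_left hy) (hE.ricci_add_right hy) (hE.ricci_smul_right hy)
  refine ⟨((GE y).inverse : (E →L[ℝ] ℝ) →ₗ[ℝ] E) ∘ₗ
    (LinearMap.toContinuousLinearMap (𝕜 := ℝ) (E := E) (F' := ℝ)).toLinearMap ∘ₗ R, fun v w => ?_⟩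
  simp only [LinearMap.comp_apply, ContinuousLinearMap.coe_coe]
  rw [hE.apply_inverse hy]
  rfl

theorem scalarCurvature_prod (hE : IsMetricOn GE U) (hF : IsMetricOn GF V) (hz : z ∈ U ×ˢ V) :
    scalarCurvature (prodMetric GE GF) z = scalarCurvature GE z.1 + scalarCurvature GF z.2 := by
  obtain ⟨AE, hAE⟩ := hE.exists_ricciEnd hz.1
  obtain ⟨AF, hAF⟩ := hF.exists_ricciEnd hz.2
  simp only [scalarCurvature]
  rw [hE.metricTrace_prod hF hz AE AF fun v w => by rw [hE.ricci_prod hF hz, hAE, hAF],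
    hE.metricTrace_eq_basisTrace hz.1 hAE, hF.metricTrace_eq_basisTrace hz.2 hAF]

omit [FiniteDimensional ℝ E] [FiniteDimensional ℝ F] in
theorem _root_.MetricCalculus.fderiv_comp_fst (hf : DifferentiableAt ℝ f z.1) (v : E × F) :
    fderiv ℝ (fun x : E × F => f x.1) z v = fderiv ℝ f z.1 v.1 := by
  have h : HasFDerivAt (fun x : E × F => f x.1) _ z := hf.hasFDerivAt.comp z hasFDerivAt_fst
  rw [h.fderiv]
  rfl

theorem gradInner_prod (hE : IsMetricOn GE U) (hF : IsMetricOn GF V) (hz : z ∈ U ×ˢ V)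
    (hf : ContDiffOn ℝ ∞ f U) (hh : ContDiffOn ℝ ∞ h U) :
    gradInner (prodMetric GE GF) (fun x => f x.1) (fun x => h x.1) z = gradInner GE f h z.1 := by
  have e : gradient (prodMetric GE GF) (fun x => h x.1) z = (gradient GE h z.1, 0) := by
    refine (hE.prod hF).ext hz fun w => ?_
    rw [(hE.prod hF).apply_gradient hz,
      fderiv_comp_fst (hh.differentiableAt_of_isOpen hE.isOpen hz.1), prodMetric_apply,
      hE.apply_gradient hz.1]
    simp
  rw [gradInner, e, fderiv_comp_fst (hf.differentiableAt_of_isOpen hE.isOpen hz.1)]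
  rfl

theorem hessian_prod (hE : IsMetricOn GE U) (hF : IsMetricOn GF V) (hz : z ∈ U ×ˢ V)
    (hf : ContDiffOn ℝ ∞ f U) (u v : E × F) :
    hessian (prodMetric GE GF) (fun x => f x.1) z u v = hessian GE f z.1 u.1 v.1 := by
  have h1 : (fun x => fderiv ℝ (fun x : E × F => f x.1) x v) =ᶠ[𝓝 z]
      fun x => (fun y => fderiv ℝ f y v.1) x.1 := by
    filter_upwards [(hE.prod hF).isOpen.mem_nhds hz] with x hx using
      fderiv_comp_fst (hf.differentiableAt_of_isOpen hE.isOpen hx.1) v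
  have h2 : DifferentiableAt ℝ (fun y => fderiv ℝ f y v.1) z.1 :=
    ((hf.fderiv_clm_of_isOpen hE.isOpen).differentiableAt_of_isOpen hE.isOpen hz.1).clm_apply
      (by fun_prop)
  rw [hessian, h1.fderiv_eq, fderiv_comp_fst (f := fun y => fderiv ℝ f y v.1) h2,
    fderiv_comp_fst (hf.differentiableAt_of_isOpen hE.isOpen hz.1), hE.christoffel_prod hF hz,
    hessian]

theorem laplacian_prod (hE : IsMetricOn GE U) (hF : IsMetricOn GF V) (hz : z ∈ U ×ˢ V)
    (hf : ContDiffOn ℝ ∞ f U) :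
    laplacian (prodMetric GE GF) (fun x => f x.1) z = laplacian GE f z.1 := by
  let A : E →ₗ[ℝ] E := IsLinearMap.mk' (hessianEnd GE f z.1)
    ⟨hE.hessianEnd_add hz.1, hE.hessianEnd_smul hz.1⟩
  rw [laplacian, hE.metricTrace_prod hF hz A 0 fun v w => by
    rw [hE.hessian_prod hF hz hf, ← hE.apply_hessianEnd hf hz.1]; simp [A]]
  rw [hE.laplacian_eq_basisTrace hf hz.1, basisTrace_eq_trace (0 : F →ₗ[ℝ] F), map_zero, add_zero]
  rfl

end IsMetricOn

end Product

/-! ### Functions of a function -/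

section Chain

variable {E : Type*} [NormedAddCommGroup E] [NormedSpace ℝ E]
  {G : E → E →L[ℝ] E →L[ℝ] ℝ} {U : Set E} {θ : E → ℝ} {y : E}

theorem fderiv_const_mul_apply (hθ : DifferentiableAt ℝ θ y) (a : ℝ) (v : E) :
    fderiv ℝ (fun z => a * θ z) y v = a * fderiv ℝ θ y v := by
  rw [fderiv_const_mul hθ]; rfl

theorem gradInner_const_mul (hθ : DifferentiableAt ℝ θ y) (a : ℝ) :
    gradInner G (fun z => a * θ z) (fun z => a * θ z) y = a ^ 2 * gradInner G θ θ y := by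
  rw [gradInner, gradInner, gradient, fderiv_const_mul hθ]
  simp only [map_smul, smul_apply, smul_eq_mul]
  rw [gradient]
  ring

theorem gradInner_const_mul_right (hθ : DifferentiableAt ℝ θ y) (a : ℝ) :
    gradInner G θ (fun z => a * θ z) y = a * gradInner G θ θ y := by
  rw [gradInner, gradInner, gradient, fderiv_const_mul hθ]
  simp only [map_smul, smul_eq_mul]
  rw [gradient]

variable [FiniteDimensional ℝ E]

theorem IsMetricOn.laplacian_exp_mul (hG : IsMetricOn G U) (hθ : ContDiffOn ℝ ∞ θ U) (hy : y ∈ U)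
    (a : ℝ) : laplacian G (fun z => Real.exp (a * θ z)) y =
      Real.exp (a * θ y) * (a * laplacian G θ y + a ^ 2 * gradInner G θ θ y) := by
  have hd : ∀ z ∈ U, HasFDerivAt (fun z => Real.exp (a * θ z))
      (Real.exp (a * θ z) • a • fderiv ℝ θ z) z := fun z hz =>
    ((hθ.differentiableAt_of_isOpen hG.isOpen hz).hasFDerivAt.const_mul a).exp
  have hH : hessian G (fun z => Real.exp (a * θ z)) y = fun u v =>
      Real.exp (a * θ y) * (a * hessian G θ y u v + a ^ 2 * (fderiv ℝ θ y u * fderiv ℝ θ y v)) := by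
    ext u v
    have h1 : (fun z => fderiv ℝ (fun z => Real.exp (a * θ z)) z v) =ᶠ[𝓝 y]
        fun z => Real.exp (a * θ z) * (a * fderiv ℝ θ z v) := by
      filter_upwards [hG.isOpen.mem_nhds hy] with z hz
      rw [(hd z hz).fderiv]
      rfl
    have h2 : DifferentiableAt ℝ (fun z => fderiv ℝ θ z v) y :=
      ((hθ.fderiv_clm_of_isOpen hG.isOpen).differentiableAt_of_isOpen hG.isOpen hy).clm_apply
        (by fun_prop)
    have h3 : HasFDerivAt (fun z => Real.exp (a * θ z) * (a * fderiv ℝ θ z v)) _ y :=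
      (hd y hy).mul (h2.hasFDerivAt.const_mul a)
    rw [hessian, h1.fderiv_eq, h3.fderiv, (hd y hy).fderiv, hessian]
    simp only [add_apply, smul_apply, smul_eq_mul]
    ring
  rw [laplacian, hH, metricTrace_const_mul, metricTrace_add, metricTrace_const_mul,
    metricTrace_const_mul, hG.metricTrace_fderiv_mul_fderiv hy, laplacian]

theorem IsMetricOn.laplacian_const_mul (hG : IsMetricOn G U) (hθ : ContDiffOn ℝ ∞ θ U) (hy : y ∈ U)
    (a : ℝ) : laplacian G (fun z => a * θ z) y = a * laplacian G θ y := by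
  have hd : ∀ z ∈ U, ∀ v, fderiv ℝ (fun z => a * θ z) z v = a * fderiv ℝ θ z v := fun z hz v =>
    fderiv_const_mul_apply (hθ.differentiableAt_of_isOpen hG.isOpen hz) a v
  have hH : hessian G (fun z => a * θ z) y = fun u v => a * hessian G θ y u v := by
    ext u v
    have h1 : (fun z => fderiv ℝ (fun z => a * θ z) z v) =ᶠ[𝓝 y]
        fun z => a * fderiv ℝ θ z v := by
      filter_upwards [hG.isOpen.mem_nhds hy] with z hz using hd z hz v
    have h2 : DifferentiableAt ℝ (fun z => fderiv ℝ θ z v) y :=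
      ((hθ.fderiv_clm_of_isOpen hG.isOpen).differentiableAt_of_isOpen hG.isOpen hy).clm_apply
        (by fun_prop)
    rw [hessian, h1.fderiv_eq, fderiv_const_mul_apply h2, hd y hy, hessian]
    ring
  rw [laplacian, hH, metricTrace_const_mul, laplacian]

end Chain

/-! ### The scalar curvature of a base conformal warped product -/

section Warped

variable {E : Type*} [NormedAddCommGroup E] [NormedSpace ℝ E] [FiniteDimensional ℝ E]
  {F : Type*} [NormedAddCommGroup F] [NormedSpace ℝ F] [FiniteDimensional ℝ F]
  {GE : E → E →L[ℝ] E →L[ℝ] ℝ} {GF : F → F →L[ℝ] F →L[ℝ] ℝ} {U : Set E} {V : Set F}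
  {θ : E → ℝ} {z : E × F}

/-- The scalar curvature of `e^{2μθ} G_E + e^{2θ} G_F`, written as
`e^{2θ} (e^{2(μ-1)θ} G_E + G_F)`. -/
theorem IsMetricOn.scalarCurvature_warped (hE : IsMetricOn GE U) (hF : IsMetricOn GF V)
    (hθ : ContDiffOn ℝ ∞ θ U) (hz : z ∈ U ×ˢ V) (μ m k : ℝ) (hm : Module.finrank ℝ E = m)
    (hk : Module.finrank ℝ F = k) :
    Real.exp (2 * μ * θ z.1) * scalarCurvature
        (MetricCalculus.conformal (fun x => θ x.1)
          (prodMetric (MetricCalculus.conformal (fun x => (μ - 1) * θ x) GE) GF)) z =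
      scalarCurvature GE z.1 - 2 * (k + (m - 1) * μ) * laplacian GE θ z.1
        - ((m - 1) * (m - 2) * μ ^ 2 + 2 * (m - 2) * k * μ + k ^ 2 + k) * gradInner GE θ θ z.1
        + Real.exp (2 * (μ - 1) * θ z.1) * scalarCurvature GF z.2 := by
  have hφ : ContDiffOn ℝ ∞ (fun x => (μ - 1) * θ x) U := contDiffOn_const.mul hθ
  have hC := hE.conformal hφ
  have hP := hC.prod hF
  have hθ' : ContDiffOn ℝ ∞ (fun x : E × F => θ x.1) (U ×ˢ V) :=
    hθ.comp contDiffOn_fst fun _ hx => hx.1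
  have hd := hθ.differentiableAt_of_isOpen hE.isOpen hz.1
  have hn : (Module.finrank ℝ (E × F) : ℝ) = m + k := by
    rw [Module.finrank_prod]; push_cast; rw [hm, hk]
  have e1 : Real.exp (2 * μ * θ z.1) =
      Real.exp (2 * ((μ - 1) * θ z.1)) * Real.exp (2 * θ z.1) := by
    rw [← Real.exp_add]; ring_nf
  have e2 : Real.exp (2 * (μ - 1) * θ z.1) = Real.exp (2 * ((μ - 1) * θ z.1)) := by ring_nf
  rw [hP.scalarCurvature_conformal hθ' hz, hC.scalarCurvature_prod hF hz,
    hC.laplacian_prod hF hz hθ, hC.gradInner_prod hF hz hθ hθ, hE.laplacian_conformal hφ hθ hz.1,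
    hE.gradInner_conformal hφ hz.1, hE.scalarCurvature_conformal hφ hz.1,
    hE.laplacian_const_mul hθ hz.1, gradInner_const_mul hd, gradInner_const_mul_right hd, hn, hm,
    e1, e2, Real.exp_neg, Real.exp_neg]
  field_simp
  ring

end Warped

end MetricCalculus

/-! ### Dependence on germs -/

namespace MetricCalculus

variable {E : Type*} [NormedAddCommGroup E] [NormedSpace ℝ E]
  {G G' : E → E →L[ℝ] E →L[ℝ] ℝ} {y : E}

theorem christoffel_congr (h : G =ᶠ[𝓝 y] G') (u v : E) :
    christoffel G y u v = christoffel G' y u v := by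
  have h1 : ∀ x, (fun z => G z x) =ᶠ[𝓝 y] fun z => G' z x := fun x => by
    filter_upwards [h] with z hz using by rw [hz]
  have h2 : (fun z => G z u v) =ᶠ[𝓝 y] fun z => G' z u v := by
    filter_upwards [h] with z hz using by rw [hz]
  rw [christoffel, christoffel, h.eq_of_nhds, (h1 u).fderiv_eq, (h1 v).fderiv_eq, h2.fderiv_eq]

theorem riemann_congr (h : G =ᶠ[𝓝 y] G') (u v w : E) :
    riemann G y u v w = riemann G' y u v w := by
  have h1 : ∀ a b, (fun z => christoffel G z a b) =ᶠ[𝓝 y] fun z => christoffel G' z a b :=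
    fun a b => by
      filter_upwards [h.eventuallyEq_nhds] with z hz using christoffel_congr hz a b
  simp only [riemann, (h1 _ _).fderiv_eq, christoffel_congr h]

theorem scalarCurvature_congr [FiniteDimensional ℝ E] (h : G =ᶠ[𝓝 y] G') :
    scalarCurvature G y = scalarCurvature G' y := by
  simp only [scalarCurvature, metricTrace, ricci, riemann_congr h, h.eq_of_nhds]

end MetricCalculus

/-! ### The metric in a chart -/

namespace PseudoRiemannianMetric

open MetricCalculus

variable {E : Type*} [NormedAddCommGroup E] [NormedSpace ℝ E]
  {H : Type*} [TopologicalSpace H] {I : ModelWithCorners ℝ E H}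
  {M : Type*} [TopologicalSpace M] [ChartedSpace H M] [IsManifold I ∞ M]
  {E' : Type*} [NormedAddCommGroup E'] [NormedSpace ℝ E']

variable [I.Boundaryless]

theorem contMDiffAt_extChartAt_symm (x₀ : M) {y : E} (hy : y ∈ (extChartAt I x₀).target) :
    ContMDiffAt 𝓘(ℝ, E) I ∞ (extChartAt I x₀).symm y :=
  (contMDiffOn_extChartAt_symm x₀).contMDiffAt ((isOpen_extChartAt_target x₀).mem_nhds hy)

set_option synthInstance.maxHeartbeats 200000 in
set_option maxHeartbeats 800000 in
/-- The coordinate expression of the metric is smooth. Near a point, in the trivialization of the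
tangent bundle there, it is the composition of the smooth metric with the smooth derivative of the
inverse of the chart. -/
theorem contDiffAt_inChart (g : PseudoRiemannianMetric I M) (x₀ : M) {y₀ : E}
    (hy : y₀ ∈ (extChartAt I x₀).target) : ContDiffAt ℝ ∞ (g.inChart x₀) y₀ := by
  rw [← contMDiffAt_iff_contDiffAt]
  have hf := contMDiffAt_extChartAt_symm x₀ hy
  unfold inChart
  -- Only the smoothness of the inverse of the chart is used.
  generalize (extChartAt I x₀).symm = f at hf ⊢
  have hg := ((contMDiffAt_hom_bundle _).1 ((g.contMDiff (f y₀)).comp y₀ hf)).2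
  have hD := ContMDiffAt.mfderiv_const (m := ∞) hf (by simp)
  have key : ContMDiffAt 𝓘(ℝ, E) 𝓘(ℝ, E →L[ℝ] E →L[ℝ] ℝ) ∞ (fun x ↦
      ((ContinuousLinearMap.compL ℝ E E ℝ).flip
        (inTangentCoordinates 𝓘(ℝ, E) I id f (mfderiv 𝓘(ℝ, E) I f) y₀ x)) ∘L
      ((ContinuousLinearMap.inCoordinates E (TangentSpace I) (E →L[ℝ] ℝ)
        (fun x ↦ TangentSpace I x →L[ℝ] ℝ) (f y₀) (f x) (f y₀) (f x) (g.inner (f x))) ∘L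
        (inTangentCoordinates 𝓘(ℝ, E) I id f (mfderiv 𝓘(ℝ, E) I f) y₀ x))) y₀ :=
    ContMDiffAt.clm_comp (ContMDiffAt.clm_apply contMDiffAt_const hD)
      (ContMDiffAt.clm_comp hg hD)
  refine key.congr_of_eventuallyEq ?_
  have h2 : ∀ᶠ x in 𝓝 y₀,
      f x ∈ (trivializationAt E (TangentSpace I (M := M)) (f y₀)).baseSet :=
    hf.continuousAt
      ((trivializationAt E (TangentSpace I (M := M)) (f y₀)).open_baseSet.mem_nhds
        (FiberBundle.mem_baseSet_trivializationAt' (f y₀)))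
  filter_upwards [h2] with x hM
  have hE : x ∈ (trivializationAt E (TangentSpace 𝓘(ℝ, E) (M := E)) y₀).baseSet :=
    Set.mem_univ x
  ext v w
  change g.inner (f x) (mfderiv 𝓘(ℝ, E) I f x v) (mfderiv 𝓘(ℝ, E) I f x w) =
    ContinuousLinearMap.inCoordinates E (TangentSpace I) (E →L[ℝ] ℝ)
      (fun x ↦ TangentSpace I x →L[ℝ] ℝ) (f y₀) (f x) (f y₀) (f x) (g.inner (f x))
      (inTangentCoordinates 𝓘(ℝ, E) I id f (mfderiv 𝓘(ℝ, E) I f) y₀ x v)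
      (inTangentCoordinates 𝓘(ℝ, E) I id f (mfderiv 𝓘(ℝ, E) I f) y₀ x w)
  rw [inCoordinates_apply_eq₂ hM hM (by simp)]
  have hD' : ∀ v : E, (trivializationAt E (TangentSpace I (M := M)) (f y₀)).symm (f x)
      (inTangentCoordinates 𝓘(ℝ, E) I id f (mfderiv 𝓘(ℝ, E) I f) y₀ x v) =
      mfderiv 𝓘(ℝ, E) I f x v := by
    intro v
    change (trivializationAt E (TangentSpace I (M := M)) (f y₀)).symm (f x)
      (ContinuousLinearMap.inCoordinates E (TangentSpace 𝓘(ℝ, E)) E (TangentSpace I)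
        y₀ x (f y₀) (f x) (mfderiv 𝓘(ℝ, E) I f x) v) = _
    rw [ContinuousLinearMap.inCoordinates_eq hE hM]
    simp only [ContinuousLinearMap.comp_apply, ContinuousLinearEquiv.coe_coe,
      Trivialization.continuousLinearEquivAt_apply, Trivialization.symm_continuousLinearEquivAt_eq]
    rw [TangentBundle.symmL_model_space]
    exact (trivializationAt E (TangentSpace I (M := M)) (f y₀)).symm_proj_apply ⟨f x, _⟩ hM
  refine (congrArg₂ (fun a b => g.inner (f x) a b) (hD' v) (hD' w)).symm.trans ?_
  have hl : ∀ r : ℝ, Bundle.Trivialization.linearMapAt ℝ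
      (trivializationAt ℝ (Bundle.Trivial M ℝ) (f y₀)) (f x) r = r := fun r => by simp
  exact (hl _).symm

theorem bijective_mfderiv_extChartAt_symm (x₀ : M) {y : E} (hy : y ∈ (extChartAt I x₀).target) :
    Function.Bijective (mfderiv 𝓘(ℝ, E) I (extChartAt I x₀).symm y) := by
  have : IsManifold I 1 M := IsManifold.of_le (n := ∞) (by simp)
  have h := isInvertible_mfderivWithin_extChartAt_symm hy
  rw [I.range_eq_univ, mfderivWithin_univ] at h
  exact h.bijective

theorem inChart_nondegenerate (g : PseudoRiemannianMetric I M) (x₀ : M) {y : E}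
    (hy : y ∈ (extChartAt I x₀).target) (v : E) (hv : ∀ w, g.inChart x₀ y v w = 0) : v = 0 := by
  have hD := bijective_mfderiv_extChartAt_symm x₀ hy
  have h0 : mfderiv 𝓘(ℝ, E) I (extChartAt I x₀).symm y v = 0 := by
    refine g.nondegenerate _ _ fun w => ?_
    obtain ⟨w', rfl⟩ := hD.2 w
    exact hv w'
  exact hD.1 (h0.trans (map_zero _).symm)

omit [I.Boundaryless] in
theorem inChart_symm (g : PseudoRiemannianMetric I M) (x₀ : M) (y v w : E) :
    g.inChart x₀ y v w = g.inChart x₀ y w v :=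
  g.symm ((extChartAt I x₀).symm y) _ _

theorem isMetricOn_inChart [FiniteDimensional ℝ E] (g : PseudoRiemannianMetric I M) (x₀ : M) :
    IsMetricOn (g.inChart x₀) (extChartAt I x₀).target := by
  have h1 : ContDiffOn ℝ ∞ (g.inChart x₀) (extChartAt I x₀).target := fun y hy =>
    (g.contDiffAt_inChart x₀ hy).contDiffWithinAt
  have h2 : ∀ y ∈ (extChartAt I x₀).target, (g.inChart x₀ y).IsInvertible := fun y hy =>
    isInvertible_of_nondegenerate (g.inChart_nondegenerate x₀ hy)
  exact ⟨isOpen_extChartAt_target x₀, h1, fun y _ => g.inChart_symm x₀ y, h2⟩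

theorem mfderiv_extChartAt_symm_self (x : M) :
    (mfderiv 𝓘(ℝ, E) I (extChartAt I x).symm (extChartAt I x x) : E →L[ℝ] E) = .id ℝ E := by
  have h := (contMDiffAt_extChartAt_symm x (mem_extChartAt_target (I := I) x)).mdifferentiableAt
    (by simp)
  have h' := fderivWithin_extChartAt_comp_extChartAt_symm_range (I := I) (x := x)
  rw [I.range_eq_univ] at h'
  have h2 : fderivWithin ℝ (extChartAt I ((extChartAt I x).symm (extChartAt I x x)) ∘
      (extChartAt I x).symm) (Set.range (id : E → E)) (extChartAt I x x) = .id ℝ E := by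
    rw [Set.range_id, extChartAt_to_inv]
    exact h'
  exact h.mfderiv.trans h2

/-- At the centre of the chart, `TangentSpace I x` is the model space itself, and the coordinate
expression of the metric is the metric. -/
theorem inChart_self (g : PseudoRiemannianMetric I M) (x : M) :
    g.inChart x (extChartAt I x x) = (g.inner x : E →L[ℝ] E →L[ℝ] ℝ) := by
  ext v w
  let G : M → E →L[ℝ] E →L[ℝ] ℝ := fun p => g.inner p
  let D : E →L[ℝ] E := mfderiv 𝓘(ℝ, E) I (extChartAt I x).symm (extChartAt I x x)
  change G ((extChartAt I x).symm (extChartAt I x x)) (D v) (D w) = G x v w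
  have hD : D = .id ℝ E := mfderiv_extChartAt_symm_self x
  rw [extChartAt_to_inv, hD]
  rfl

theorem normSqGrad_eq_gradInner [FiniteDimensional ℝ E] (g : PseudoRiemannianMetric I M)
    {f : M → ℝ} (hf : ContMDiff I 𝓘(ℝ) ∞ f) (x : M) :
    g.normSqGrad f x =
      gradInner (g.inChart x) (f ∘ (extChartAt I x).symm) (f ∘ (extChartAt I x).symm)
        (extChartAt I x x) := by
  have hd : mvfderiv I f x = fderiv ℝ (f ∘ (extChartAt I x).symm) (extChartAt I x x) := by
    have h := (hf x).mdifferentiableAt (by simp)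
    have h' := h.mfderiv
    rw [I.range_eq_univ, fderivWithin_univ] at h'
    ext v
    exact congrArg (fun D : E →L[ℝ] ℝ => D v) h'
  have hg : g.grad f x =
      MetricCalculus.gradient (g.inChart x) (f ∘ (extChartAt I x).symm) (extChartAt I x x) := by
    rw [grad, MetricCalculus.gradient, hd, inChart_self]
    rfl
  have hG := g.isMetricOn_inChart x
  rw [gradInner, ← hG.apply_gradient (mem_extChartAt_target x), ← hg, inChart_self]
  rfl

theorem contDiffOn_comp_extChartAt_symm {f : M → ℝ} (hf : ContMDiff I 𝓘(ℝ) ∞ f) (x : M) :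
    ContDiffOn ℝ ∞ (f ∘ (extChartAt I x).symm) (extChartAt I x).target := fun _ hy =>
  (contMDiffAt_iff_contDiffAt.1
    ((hf _).comp _ (contMDiffAt_extChartAt_symm x hy))).contDiffWithinAt

end PseudoRiemannianMetric

/-! ### The warped metric in a product chart -/

namespace PseudoRiemannianMetric

open MetricCalculus

variable {EB : Type*} [NormedAddCommGroup EB] [NormedSpace ℝ EB]
  {HB : Type*} [TopologicalSpace HB] {IB : ModelWithCorners ℝ EB HB} [IB.Boundaryless]
  {B : Type*} [TopologicalSpace B] [ChartedSpace HB B] [IsManifold IB ∞ B]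
  {EF : Type*} [NormedAddCommGroup EF] [NormedSpace ℝ EF]
  {HF : Type*} [TopologicalSpace HF] {IF : ModelWithCorners ℝ EF HF} [IF.Boundaryless]
  {F : Type*} [TopologicalSpace F] [ChartedSpace HF F] [IsManifold IF ∞ F]

/-- In a product chart, a base conformal warped product has the coordinate expression of a base
conformal warped product. -/
theorem inChart_bcwp (gB : PseudoRiemannianMetric IB B) (gF : PseudoRiemannianMetric IF F)
    (c w : B → ℝ) (hc : ContMDiff IB 𝓘(ℝ) ∞ c) (hc0 : ∀ x, 0 < c x)
    (hw : ContMDiff IB 𝓘(ℝ) ∞ w) (hw0 : ∀ x, 0 < w x) (x : B) (y : F) {z : EB × EF}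
    (hz : z ∈ (extChartAt IB x).target ×ˢ (extChartAt IF y).target) (u v : EB × EF) :
    (gB.bcwp gF c w hc hc0 hw hw0).inChart (x, y) z u v =
      c ((extChartAt IB x).symm z.1) ^ 2 * gB.inChart x z.1 u.1 v.1 +
        w ((extChartAt IB x).symm z.1) ^ 2 * gF.inChart y z.2 u.2 v.2 := by
  have hB := (contMDiffAt_extChartAt_symm x hz.1).mdifferentiableAt (by simp)
  have hF := (contMDiffAt_extChartAt_symm y hz.2).mdifferentiableAt (by simp)
  have hD := (contMDiffAt_extChartAt_symm (I := IB.prod IF) (x, y) (y := z)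
    (by rw [extChartAt_prod]; exact hz)).mdifferentiableAt (by simp)
  have h1 : ∀ a : EB × EF, mfderiv (IB.prod IF) IB Prod.fst
      ((extChartAt (IB.prod IF) (x, y)).symm z)
      (mfderiv 𝓘(ℝ, EB × EF) (IB.prod IF) (extChartAt (IB.prod IF) (x, y)).symm z a) =
      mfderiv 𝓘(ℝ, EB) IB (extChartAt IB x).symm z.1 a.1 := by
    intro a
    have e1 := mfderiv_comp z (mdifferentiableAt_fst (I := IB) (I' := IF)) hD
    have e2 := mfderiv_comp z (f := (Prod.fst : EB × EF → EB)) (I' := 𝓘(ℝ, EB)) hB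
      differentiableAt_fst.mdifferentiableAt
    have e3 : (Prod.fst : B × F → B) ∘ (extChartAt (IB.prod IF) (x, y)).symm =
      (extChartAt IB x).symm ∘ (Prod.fst : EB × EF → EB) := by
      ext p; rw [extChartAt_prod]; rfl
    rw [e3, e2, mfderiv_eq_fderiv, fderiv_fst] at e1
    exact (congrArg (fun D : EB × EF →L[ℝ] EB => D a) e1).symm
  have h2 : ∀ a : EB × EF, mfderiv (IB.prod IF) IF Prod.snd
      ((extChartAt (IB.prod IF) (x, y)).symm z)
      (mfderiv 𝓘(ℝ, EB × EF) (IB.prod IF) (extChartAt (IB.prod IF) (x, y)).symm z a) =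
      mfderiv 𝓘(ℝ, EF) IF (extChartAt IF y).symm z.2 a.2 := by
    intro a
    have e1 := mfderiv_comp z (mdifferentiableAt_snd (I := IB) (I' := IF)) hD
    have e2 := mfderiv_comp z (f := (Prod.snd : EB × EF → EF)) (I' := 𝓘(ℝ, EF)) hF
      differentiableAt_snd.mdifferentiableAt
    have e3 : (Prod.snd : B × F → F) ∘ (extChartAt (IB.prod IF) (x, y)).symm =
      (extChartAt IF y).symm ∘ (Prod.snd : EB × EF → EF) := by
      ext p; rw [extChartAt_prod]; rfl
    rw [e3, e2, mfderiv_eq_fderiv, fderiv_snd] at e1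
    exact (congrArg (fun D : EB × EF →L[ℝ] EF => D a) e1).symm
  let p := (extChartAt (IB.prod IF) (x, y)).symm z
  have hp1 : p.1 = (extChartAt IB x).symm z.1 := by
    simp only [p]; rw [extChartAt_prod]; rfl
  have hp2 : p.2 = (extChartAt IF y).symm z.2 := by
    simp only [p]; rw [extChartAt_prod]; rfl
  let TB : B → EB →L[ℝ] EB →L[ℝ] ℝ := fun b => gB.inner b
  let TF : F → EF →L[ℝ] EF →L[ℝ] ℝ := fun b => gF.inner b
  let A : EB × EF → EB × EF :=
    fun a => mfderiv 𝓘(ℝ, EB × EF) (IB.prod IF) (extChartAt (IB.prod IF) (x, y)).symm z a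
  change c p.1 ^ 2 * TB p.1 (mfderiv (IB.prod IF) IB Prod.fst p (A u))
      (mfderiv (IB.prod IF) IB Prod.fst p (A v)) +
    w p.1 ^ 2 * TF p.2 (mfderiv (IB.prod IF) IF Prod.snd p (A u))
      (mfderiv (IB.prod IF) IF Prod.snd p (A v)) = _
  rw [hp1, hp2]
  exact congrArg₂ (fun s t : ℝ => c _ ^ 2 * s + w _ ^ 2 * t)
    (congrArg₂ (fun a b => TB _ a b) (h1 u) (h1 v)) (congrArg₂ (fun a b => TF _ a b) (h2 u) (h2 v))

end PseudoRiemannianMetric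

/-! ### The scalar curvature of a base conformal warped product of manifolds -/

namespace PseudoRiemannianMetric

open MetricCalculus

section Functions

variable {E : Type*} [NormedAddCommGroup E] [NormedSpace ℝ E] [FiniteDimensional ℝ E]
  {H : Type*} [TopologicalSpace H] {I : ModelWithCorners ℝ E H} [I.Boundaryless]
  {M : Type*} [TopologicalSpace M] [ChartedSpace H M] [IsManifold I ∞ M]

theorem laplacian_exp_mul (g : PseudoRiemannianMetric I M) {θ : M → ℝ}
    (hθ : ContMDiff I 𝓘(ℝ) ∞ θ) (a : ℝ) (x : M) :
    g.laplacian (fun p => Real.exp (a * θ p)) x =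
      Real.exp (a * θ x) * (a * g.laplacian θ x + a ^ 2 * g.normSqGrad θ x) := by
  have h := (g.isMetricOn_inChart x).laplacian_exp_mul (contDiffOn_comp_extChartAt_symm hθ x)
    (mem_extChartAt_target x) a
  rw [g.normSqGrad_eq_gradInner hθ]
  simp only [Function.comp_apply, extChartAt_to_inv] at h
  exact h

theorem normSqGrad_exp (g : PseudoRiemannianMetric I M) {θ : M → ℝ}
    (hθ : ContMDiff I 𝓘(ℝ) ∞ θ) (x : M) :
    g.normSqGrad (fun p => Real.exp (θ p)) x = Real.exp (θ x) ^ 2 * g.normSqGrad θ x := by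
  have hexp : ContMDiff I 𝓘(ℝ) ∞ fun p => Real.exp (θ p) := Real.contDiff_exp.contMDiff.comp hθ
  have hd : HasFDerivAt (fun z => Real.exp ((θ ∘ (extChartAt I x).symm) z)) _ (extChartAt I x x) :=
    ((contDiffOn_comp_extChartAt_symm hθ x).differentiableAt_of_isOpen
      (isOpen_extChartAt_target x) (mem_extChartAt_target x)).hasFDerivAt.exp
  have hc : (fun p => Real.exp (θ p)) ∘ (extChartAt I x).symm =
      fun z => Real.exp ((θ ∘ (extChartAt I x).symm) z) := rfl
  rw [g.normSqGrad_eq_gradInner hθ, g.normSqGrad_eq_gradInner hexp,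
    hc, gradInner, MetricCalculus.gradient, hd.fderiv, gradInner, MetricCalculus.gradient]
  simp only [map_smul, smul_apply, smul_eq_mul, Function.comp_apply, extChartAt_to_inv]
  ring

end Functions

variable {EB : Type*} [NormedAddCommGroup EB] [NormedSpace ℝ EB] [FiniteDimensional ℝ EB]
  {HB : Type*} [TopologicalSpace HB] {IB : ModelWithCorners ℝ EB HB} [IB.Boundaryless]
  {B : Type*} [TopologicalSpace B] [ChartedSpace HB B] [IsManifold IB ∞ B]
  {EF : Type*} [NormedAddCommGroup EF] [NormedSpace ℝ EF] [FiniteDimensional ℝ EF]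
  {HF : Type*} [TopologicalSpace HF] {IF : ModelWithCorners ℝ EF HF} [IF.Boundaryless]
  {F : Type*} [TopologicalSpace F] [ChartedSpace HF F] [IsManifold IF ∞ F]

omit [FiniteDimensional ℝ EB] [IB.Boundaryless] [IsManifold IB ∞ B] in
theorem _root_.ContMDiff.log_of_pos {ψ : B → ℝ} (hψ : ContMDiff IB 𝓘(ℝ) ∞ ψ)
    (hψ0 : ∀ x, 0 < ψ x) : ContMDiff IB 𝓘(ℝ) ∞ fun p => Real.log (ψ p) := fun x =>
  (Real.contDiffAt_log.2 (hψ0 x).ne').contMDiffAt.comp x (hψ x)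

/-- The scalar curvature of a base conformal warped product in terms of `log ψ`. -/
theorem scalarCurvature_psiMuBcwp (gB : PseudoRiemannianMetric IB B)
    (gF : PseudoRiemannianMetric IF F) (ψ : B → ℝ) (μ m k : ℝ) (hψ : ContMDiff IB 𝓘(ℝ) ∞ ψ)
    (hψ0 : ∀ x, 0 < ψ x) (hm : Module.finrank ℝ EB = m) (hk : Module.finrank ℝ EF = k)
    (x : B) (y : F) :
    ψ x ^ (2 * μ) * (gB.psiMuBcwp gF ψ μ hψ hψ0).scalarCurvature (x, y) =
      gB.scalarCurvature x
        - 2 * (k + (m - 1) * μ) * gB.laplacian (fun p => Real.log (ψ p)) x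
        - ((m - 1) * (m - 2) * μ ^ 2 + 2 * (m - 2) * k * μ + k ^ 2 + k)
          * gB.normSqGrad (fun p => Real.log (ψ p)) x
        + ψ x ^ (2 * (μ - 1)) * gF.scalarCurvature y := by
  have hθ := hψ.log_of_pos hψ0
  let θ : EB → ℝ := (fun p => Real.log (ψ p)) ∘ (extChartAt IB x).symm
  have hz : (extChartAt IB x x, extChartAt IF y y) ∈
      (extChartAt IB x).target ×ˢ (extChartAt IF y).target :=
    ⟨mem_extChartAt_target x, mem_extChartAt_target y⟩
  have hopen : IsOpen ((extChartAt IB x).target ×ˢ (extChartAt IF y).target) :=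
    (isOpen_extChartAt_target x).prod (isOpen_extChartAt_target y)
  have hloc : (gB.psiMuBcwp gF ψ μ hψ hψ0).inChart (x, y)
      =ᶠ[𝓝 (extChartAt IB x x, extChartAt IF y y)] conformal (fun z => θ z.1)
        (prodMetric (conformal (fun z => (μ - 1) * θ z) (gB.inChart x)) (gF.inChart y)) := by
    filter_upwards [hopen.mem_nhds hz] with z hz
    refine ContinuousLinearMap.ext fun u => ContinuousLinearMap.ext fun v => ?_
    refine (inChart_bcwp gB gF (fun p => ψ p ^ μ) ψ _ _ hψ hψ0 x y hz u v).trans ?_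
    have hp := hψ0 ((extChartAt IB x).symm z.1)
    have hθz : θ z.1 = Real.log (ψ ((extChartAt IB x).symm z.1)) := rfl
    simp only [conformal, smul_apply, prodMetric_apply, smul_eq_mul, hθz]
    rw [mul_add, ← mul_assoc, ← Real.exp_add, Real.rpow_def_of_pos hp, ← Real.exp_nat_mul]
    congr 2
    · congr 1; push_cast; ring
    · rw [two_mul, Real.exp_add, Real.exp_log hp, sq]
  have hx : θ (extChartAt IB x x) = Real.log (ψ x) := by simp [θ]
  have h := (gB.isMetricOn_inChart x).scalarCurvature_warped (gF.isMetricOn_inChart y)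
    (contDiffOn_comp_extChartAt_symm hθ x) hz μ m k hm hk
  rw [gB.normSqGrad_eq_gradInner hθ]
  have hS : (gB.psiMuBcwp gF ψ μ hψ hψ0).scalarCurvature (x, y) = MetricCalculus.scalarCurvature
      ((gB.psiMuBcwp gF ψ μ hψ hψ0).inChart (x, y)) (extChartAt IB x x, extChartAt IF y y) := by
    rw [scalarCurvature, extChartAt_prod]; rfl
  rw [hS, scalarCurvature_congr hloc, Real.rpow_def_of_pos (hψ0 x), Real.rpow_def_of_pos (hψ0 x),
    mul_comm (Real.log _), mul_comm (Real.log _), ← hx]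
  exact h

end PseudoRiemannianMetric

end

theorem mainTheorem4
    {EB : Type*} [NormedAddCommGroup EB] [NormedSpace ℝ EB] [FiniteDimensional ℝ EB]
    {HB : Type*} [TopologicalSpace HB] (IB : ModelWithCorners ℝ EB HB) [IB.Boundaryless]
    {B : Type*} [TopologicalSpace B] [ChartedSpace HB B] [IsManifold IB ∞ B]
    {EF : Type*} [NormedAddCommGroup EF] [NormedSpace ℝ EF] [FiniteDimensional ℝ EF]
    {HF : Type*} [TopologicalSpace HF] (IF : ModelWithCorners ℝ EF HF) [IF.Boundaryless]
    {F : Type*} [TopologicalSpace F] [ChartedSpace HF F] [IsManifold IF ∞ F]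
    (m k : ℕ) (hdimB : Module.finrank ℝ EB = m) (hdimF : Module.finrank ℝ EF = k) (hm : 2 ≤ m)
    (gB : PseudoRiemannianMetric IB B) (gF : PseudoRiemannianMetric IF F)
    (μ : ℝ) (ψ : B → ℝ) (hψ : ContMDiff IB 𝓘(ℝ) ∞ ψ) (hψ0 : ∀ x, 0 < ψ x) :
    (μ ≠ -(k : ℝ) / ((m : ℝ) - 1) → (m, k) ≠ (2, 0) →
      ∀ α β : ℝ,
        α = 2 * (k + (m - 1) * μ) /
          (((k + (m - 1) * μ) + (1 - μ)) * k + (m - 2) * μ * (k + (m - 1) * μ)) →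
        β = α * 2 * (k + (m - 1) * μ) →
        0 < β ∧
        (∃ u : B → ℝ, ContMDiff IB 𝓘(ℝ) ∞ u ∧ (∀ x, 0 < u x) ∧ ∀ x, ψ x = u x ^ α) ∧
        ∀ u : B → ℝ, (∀ x, 0 < u x) → (∀ x, ψ x = u x ^ α) →
          ContMDiff IB 𝓘(ℝ) ∞ u ∧
          ∀ (x : B) (y : F),
            -β * gB.laplacian u x + gB.scalarCurvature x * u x =
              (gB.psiMuBcwp gF ψ μ hψ hψ0).scalarCurvature (x, y) * u x ^ (2 * μ * α + 1)
                - gF.scalarCurvature y * u x ^ (2 * (μ - 1) * α + 1)) ∧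
    (μ = -(k : ℝ) / ((m : ℝ) - 1) →
      ∀ (x : B) (y : F),
        -(k : ℝ) * (1 + (k : ℝ) / ((m : ℝ) - 1)) * (gB.normSqGrad ψ x / ψ x ^ 2) =
          ψ x ^ (-2 * ((k : ℝ) / ((m : ℝ) - 1))) *
              ((gB.psiMuBcwp gF ψ μ hψ hψ0).scalarCurvature (x, y)
                - gF.scalarCurvature y * ψ x ^ (-2 : ℝ))
            - gB.scalarCurvature x) := by
  -- With `θ = log ψ`: `ψ^(2μ) S = S_B - 2κ Δθ - D |∇θ|² + ψ^(2(μ-1)) S_F`.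
  have hS := fun x y => gB.scalarCurvature_psiMuBcwp gF ψ μ m k hψ hψ0
    (by rw [hdimB]) (by rw [hdimF]) x y
  have hθ := hψ.log_of_pos hψ0
  have hm2 : (2 : ℝ) ≤ m := by exact_mod_cast hm
  have hk0 : (0 : ℝ) ≤ k := Nat.cast_nonneg k
  have hm1 : (m : ℝ) - 1 ≠ 0 := by linarith
  refine ⟨fun hμ hmk α β hα hβ => ?_, fun hμ x y => ?_⟩
  · -- Here `u = exp (θ / α)`, `Δu = u (Δθ / α + |∇θ|² / α²)`, `β / α = 2κ` and `β / α² = D`.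
    set κ : ℝ := k + (m - 1) * μ with hκ
    set D : ℝ := (m - 1) * (m - 2) * μ ^ 2 + 2 * (m - 2) * k * μ + k ^ 2 + k with hD
    have hκ0 : κ ≠ 0 := fun h => hμ (by rw [eq_div_iff hm1]; linarith)
    have hDα : α = 2 * κ / D := by rw [hα]; congr 1; rw [hD, hκ]; ring
    have hD0 : 0 < D := by
      -- Complete the square: `(m - 1) D = (m - 2) κ² + k (m - 1 + k)`
      have e : ((m : ℝ) - 1) * D = (m - 2) * κ ^ 2 + k * (m - 1 + k) := by rw [hD, hκ]; ring
      have hpos : 0 < ((m : ℝ) - 1) * D := by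
        rw [e]
        have h1 : 0 ≤ ((m : ℝ) - 2) * κ ^ 2 := mul_nonneg (by linarith) (sq_nonneg _)
        have h2 : 0 ≤ (k : ℝ) * (m - 1 + k) := mul_nonneg hk0 (by linarith)
        rcases Nat.eq_zero_or_pos k with hk | hk
        · have hm3 : (2 : ℝ) < m := by
            have : m ≠ 2 := fun h => hmk (by rw [h, hk])
            exact_mod_cast lt_of_le_of_ne hm this.symm
          have : 0 < ((m : ℝ) - 2) * κ ^ 2 := mul_pos (by linarith) (by positivity)
          linarith
        · have hk' : (0 : ℝ) < k := by exact_mod_cast hk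
          have : 0 < (k : ℝ) * (m - 1 + k) := mul_pos hk' (by linarith)
          linarith
      exact pos_of_mul_pos_right hpos (by linarith)
    have hα0 : α ≠ 0 := by rw [hDα]; exact div_ne_zero (mul_ne_zero two_ne_zero hκ0) hD0.ne'
    have hexp : ∀ a : ℝ, ContMDiff IB 𝓘(ℝ) ∞ fun p => Real.exp (a * Real.log (ψ p)) := fun a =>
      (Real.contDiff_exp.comp (contDiff_const.mul contDiff_id)).contMDiff.comp hθ
    refine ⟨?_, ⟨fun p => Real.exp (α⁻¹ * Real.log (ψ p)), hexp _, fun _ => Real.exp_pos _,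
      fun p => ?_⟩, fun u hu hψu => ?_⟩
    · have : β = 4 * κ ^ 2 / D := by rw [hβ, hDα]; ring
      rw [this]; positivity
    · rw [← Real.exp_mul, mul_comm α⁻¹, mul_assoc, inv_mul_cancel₀ hα0, mul_one,
        Real.exp_log (hψ0 p)]
    · have hue : u = fun p => Real.exp (α⁻¹ * Real.log (ψ p)) := by
        ext p
        rw [hψu, Real.log_rpow (hu p), inv_mul_cancel_left₀ hα0, Real.exp_log (hu p)]
      refine ⟨hue ▸ hexp _, fun x y => ?_⟩
      have hL : gB.laplacian u x = u x * (α⁻¹ * gB.laplacian (fun p => Real.log (ψ p)) x +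
          α⁻¹ ^ 2 * gB.normSqGrad (fun p => Real.log (ψ p)) x) := by
        conv_lhs => rw [hue]
        rw [gB.laplacian_exp_mul hθ, hue]
      have hpow : ∀ s : ℝ, u x ^ (s * α + 1) = ψ x ^ s * u x := fun s => by
        rw [Real.rpow_add (hu x), Real.rpow_one, mul_comm s, Real.rpow_mul (hu x).le, ← hψu]
      have hβ1 : β * α⁻¹ = 2 * κ := by rw [hβ]; field_simp
      have hβ2 : β * α⁻¹ ^ 2 = D := by
        rw [sq, ← mul_assoc, hβ1, hDα]; field_simp
      rw [hpow, hpow, hL]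
      linear_combination (-u x) * hS x y - u x * gB.laplacian (fun p => Real.log (ψ p)) x * hβ1
        - u x * gB.normSqGrad (fun p => Real.log (ψ p)) x * hβ2
  · -- Here `κ = 0`, so the Laplacian disappears, and `|∇ψ|² / ψ² = |∇θ|²`.
    have hN : gB.normSqGrad ψ x / ψ x ^ 2 = gB.normSqGrad (fun p => Real.log (ψ p)) x := by
      have e : ψ = fun p => Real.exp (Real.log (ψ p)) := by
        ext p; rw [Real.exp_log (hψ0 p)]
      have h := gB.normSqGrad_exp hθ x
      rw [← e, Real.exp_log (hψ0 x)] at h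
      rw [h, mul_div_cancel_left₀ _ (pow_pos (hψ0 x) 2).ne']
    have hκ : (k : ℝ) + (m - 1) * μ = 0 := by rw [hμ]; field_simp; ring
    have hD : ((m : ℝ) - 1) * (m - 2) * μ ^ 2 + 2 * (m - 2) * k * μ + k ^ 2 + k =
        k * (1 + k / (m - 1)) := by rw [hμ]; field_simp; ring
    have he : -2 * ((k : ℝ) / (m - 1)) = 2 * μ := by rw [hμ]; ring
    have hp : ψ x ^ (2 * (μ - 1)) = ψ x ^ (2 * μ) * ψ x ^ (-2 : ℝ) := by
      rw [← Real.rpow_add (hψ0 x)]; ring_nf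
    have h := hS x y
    rw [hκ, hD, hp] at h
    rw [hN, he]
    linear_combination -h
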